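/- For $n\ge 2$ and a simple graph $G$ on the vertex set $[n]=\{1,\dots,n\}$ let $Y_{ij}=+1$ if $ij$ is an edge of $G$, $Y_{ij}=-1$ if $i\ne j$ and $ij$ is not an edge, and $Y_{ii}=0$; put $k_i=\sum_{j=1}^n Y_{ij}$. For $\theta>0$ and $\boldsymbol\beta\in\mathbb R^n$ the degree-corrected two-star model is the probability distribution on graphs $$\mathbb P_{n,\theta,\boldsymbol\beta}(G)=\frac1{Z_n(\boldsymbol\beta,\theta)}\exp\Big\{\frac{\theta}{n-1}\sum_{i=1}^n\sum_{j<k}Y_{ij}Y_{ik}+\frac12\sum_{i=1}^n\beta_ik_i\Big\},$$ where $Z_n(\boldsymbol\beta,\theta)$ is the normalizing constant. For $\beta_0\in\mathbb R$ and $s,A>0$ let $\Xi_n(s,A)$ be the set of vectors $\beta_0\mathbf 1+\boldsymbol\mu$, $\boldsymbol\mu\in\mathbb R^n$, with $|\operatorname{supp}\boldsymbol\mu|\ge s$ and $\mu_i\ge A$ for all $i\in\operatorname{supp}\boldsymbol\mu$. A (nonrandomized) test of $\boldsymbol\beta=\beta_0\mathbf 1$ against $\boldsymbol\beta\in\Xi_n(s,A)$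 is a function $T_n$ from the graphs on $[n]$ to $\{0,1\}$, with risk $$R_n(T_n)=\mathbb P_{n,\theta,\beta_0\mathbf 1}(T_n=1)+\sup_{\boldsymbol\beta\in\Xi_n(s,A)}\mathbb P_{n,\theta,\boldsymbol\beta}(T_n=0).$$ For $s=s_n$ and $A=A_n$, a sequence of tests $(T_n)$ is asymptotically powerful if $\lim_{n\to\infty}R_n(T_n)=0$, and asymptotically not powerful if $\liminf_{n\to\infty}R_n(T_n)>0$. Theorem. Let $(\theta,\beta_0)=(\tfrac12,0)$, and let $s=n^b$ and $A=n^t$ with fixed $b\in(0,1)$ and $t<0$. (a) If $b+t+\tfrac12<0$, then every sequence of tests is asymptotically not powerful. (b) If $b+t+\tfrac12>0$, then there is a sequence $(L_n)$ with $L_n/n^{3/2}\to\infty$ such that the total degree test, $T_n(G)=1$ if $\sum_{i=1}^nk_i>L_n$ and $T_n(G)=0$ otherwise, is asymptotically powerful. -/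

import Mathlib

open Filter Topology

noncomputable section

namespace TwoStar

open Classical in
/-- The `±1` adjacency matrix `Y` of a simple graph on `n` labelled vertices: `+1` for an edge, `-1`
for a non-edge, and `0` on the diagonal. -/
def adj {n : ℕ} (G : SimpleGraph (Fin n)) (i j : Fin n) : ℝ :=
  if i = j then 0 else if G.Adj i j then 1 else -1

/-- The `±1` degree `k_i = ∑_j Y_ij`. -/
def deg {n : ℕ} (G : SimpleGraph (Fin n)) (i : Fin n) : ℝ :=
  ∑ j, adj G i j

/-- The `±1` two-star count `∑_i ∑_{j<k} Y_ij Y_ik`. -/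
def twoStars {n : ℕ} (G : SimpleGraph (Fin n)) : ℝ :=
  ∑ i, ∑ j, ∑ k ∈ Finset.Ioi j, adj G i j * adj G i k

/-- The unnormalised probability mass of `G` in the degree-corrected two-star model. -/
def weight {n : ℕ} (θ : ℝ) (β : Fin n → ℝ) (G : SimpleGraph (Fin n)) : ℝ :=
  Real.exp (θ / ((n : ℝ) - 1) * twoStars G + 1 / 2 * ∑ i, β i * deg G i)

open Classical in
/-- The normalising constant `Z_n(β, θ)`. -/
def partitionFunction {n : ℕ} (θ : ℝ) (β : Fin n → ℝ) : ℝ :=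
  ∑ G : SimpleGraph (Fin n), weight θ β G

/-- The probability mass function of the degree-corrected two-star model. -/
def mass {n : ℕ} (θ : ℝ) (β : Fin n → ℝ) (G : SimpleGraph (Fin n)) : ℝ :=
  weight θ β G / partitionFunction θ β

open Classical in
/-- The probability of an event (a set of graphs) in the degree-corrected two-star model. -/
def prob {n : ℕ} (θ : ℝ) (β : Fin n → ℝ) (E : Set (SimpleGraph (Fin n))) : ℝ :=
  ∑ G : SimpleGraph (Fin n), if G ∈ E then mass θ β G else 0

/-- The alternative `Ξ(s, A)`: the vectors `β₀ 1 + μ` with `|supp μ| ≥ s` and `μ_i ≥ A` for every `i`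
in `supp μ`. -/
def alternatives (n : ℕ) (β₀ s A : ℝ) : Set (Fin n → ℝ) :=
  {β | ∃ μ : Fin n → ℝ, (∀ i, β i = β₀ + μ i) ∧
    s ≤ ((Function.support μ).ncard : ℝ) ∧ ∀ i ∈ Function.support μ, A ≤ μ i}

/-- The risk of a nonrandomised test: the type I error plus the worst type II error over `Ξ(s, A)`. -/
def risk {n : ℕ} (θ β₀ s A : ℝ) (T : SimpleGraph (Fin n) → Fin 2) : ℝ :=
  prob θ (fun _ => β₀) {G | T G = 1} +
    sSup ((fun β => prob θ β {G | T G = 0}) '' alternatives n β₀ s A)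

/-- A sequence of tests is asymptotically powerful (signal sizes `s n`, strengths `A n`) if its risk
tends to `0`. -/
def AsympPowerful (θ β₀ : ℝ) (s A : ℕ → ℝ) (T : ∀ n, SimpleGraph (Fin n) → Fin 2) : Prop :=
  Tendsto (fun n => risk θ β₀ (s n) (A n) (T n)) atTop (𝓝 0)

/-- A sequence of tests is asymptotically not powerful if the lower limit of its risk is positive. -/
def AsympNotPowerful (θ β₀ : ℝ) (s A : ℕ → ℝ) (T : ∀ n, SimpleGraph (Fin n) → Fin 2) : Prop :=
  0 < liminf (fun n => risk θ β₀ (s n) (A n) (T n)) atTop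

open Classical in
/-- The total degree test, which rejects (takes the value `1`) when `∑_i k_i > L`. -/
def totalDegreeTest {n : ℕ} (L : ℝ) (G : SimpleGraph (Fin n)) : Fin 2 :=
  if L < ∑ i, deg G i then 1 else 0

end TwoStar

end

/-!
For `θ ≥ 0` the model satisfies the FKG lattice condition, so expectations of increasing functions
of the graph increase with the field. Given the other pairs, `Y_ij` has mean `tanh` of a local field
which is affine in the degrees; as `x - tanh x` is increasing, mean degrees respond to a change `δ`
of the field at most as they would if `tanh` were linear. For `θ ≤ 1 / 2` this gives
`⟨δ, m(β + δ) - m(β)⟩ ≤ 2 n (∑ i, δ i) ^ 2`, which by convexity of the log-partition function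
bounds both the Hellinger distance between the two hypotheses (whence the lower bound) and the
exponential moments of the degrees. At `θ = 1 / 2` the linear terms of the mean-field equations
cancel, and the cubic term of `tanh` yields `√n ∑ i, β i ≤ C (1 + K / n ^ (3 / 2)) ^ 3` for the mean
total degree `K`. A signal with `s A √n → ∞` therefore moves the total degree by much more than its
fluctuations, which are of order `n ^ (3 / 2)`.
-/

namespace TwoStar

open Real
open scoped Matrix

theorem one_le_natCast_sub_one {n : ℕ} (hn : 2 ≤ n) : (1 : ℝ) ≤ n - 1 := by
  rw [le_sub_iff_add_le, one_add_one_eq_two]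
  exact_mod_cast hn

theorem hasDerivAt_tanh (x : ℝ) : HasDerivAt tanh (1 - tanh x ^ 2) x := by
  have hcosh := (cosh_pos x).ne'
  have hdiv := (hasDerivAt_sinh x).fun_div (hasDerivAt_cosh x) hcosh
  simp only [← tanh_eq_sinh_div_cosh] at hdiv
  refine hdiv.congr_deriv ?_
  rw [tanh_eq_sinh_div_cosh]
  field_simp

theorem monotone_sub_tanh : Monotone fun x : ℝ => x - tanh x := by
  have hderiv : ∀ x, HasDerivAt (fun x : ℝ => x - tanh x) (1 - (1 - tanh x ^ 2)) x := fun x =>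
    (hasDerivAt_id x).fun_sub (hasDerivAt_tanh x)
  refine monotone_of_deriv_nonneg (fun x => (hderiv x).differentiableAt) fun x => ?_
  rw [(hderiv x).deriv, sub_sub_cancel]
  positivity

theorem tanh_le_self {x : ℝ} (hx : 0 ≤ x) : tanh x ≤ x := by
  simpa using monotone_sub_tanh hx

theorem self_le_tanh {x : ℝ} (hx : x ≤ 0) : x ≤ tanh x := by
  simpa using monotone_sub_tanh hx

theorem tanh_sq_le_sq (x : ℝ) : tanh x ^ 2 ≤ x ^ 2 := by
  rcases le_total 0 x with hx | hx
  · have htanh : 0 ≤ tanh x := by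
      rw [tanh_eq_sinh_div_cosh]
      exact div_nonneg (sinh_nonneg_iff.2 hx) (cosh_pos x).le
    have := tanh_le_self hx
    gcongr
  · have htanh : tanh x ≤ 0 := by
      rw [tanh_eq_sinh_div_cosh]
      exact div_nonpos_of_nonpos_of_nonneg (sinh_nonpos_iff.2 hx) (cosh_pos x).le
    nlinarith [self_le_tanh hx]

theorem monotone_tanh_sub_add_cube : Monotone fun x : ℝ => tanh x - x + x ^ 3 / 3 := by
  have hderiv : ∀ x, HasDerivAt (fun x : ℝ => tanh x - x + x ^ 3 / 3)
      (1 - tanh x ^ 2 - 1 + (3 : ℕ) * x ^ 2 / 3) x := fun x =>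
    ((hasDerivAt_tanh x).fun_sub (hasDerivAt_id x)).fun_add ((hasDerivAt_pow 3 x).div_const 3)
  refine monotone_of_deriv_nonneg (fun x => (hderiv x).differentiableAt) fun x => ?_
  rw [(hderiv x).deriv]
  push_cast
  linarith [tanh_sq_le_sq x]

theorem sub_posPart_cube_le_tanh (x : ℝ) : x - x⁺ ^ 3 / 3 ≤ tanh x := by
  rcases le_total x 0 with hx | hx
  · simpa [posPart_eq_zero.2 hx] using self_le_tanh hx
  · have := monotone_tanh_sub_add_cube hx
    norm_num [posPart_eq_self.2 hx] at this ⊢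
    linarith

theorem posPart_cube_le_mul_exp_div {c : ℝ} (hc : 0 < c) (x : ℝ) :
    x⁺ ^ 3 ≤ 6 * c ^ 3 * exp (x / c) := by
  rcases le_total x 0 with hx | hx
  · rw [posPart_eq_zero.2 hx, zero_pow three_ne_zero]
    positivity
  · have := pow_div_factorial_le_exp (x / c) (by positivity) 3
    rw [div_pow, div_div, div_le_iff₀ (by positivity)] at this
    rw [posPart_eq_self.2 hx]
    norm_num [Nat.factorial] at this
    linarith

theorem exp_two_mul_mul_one_sub_tanh (x : ℝ) : exp (2 * x) * (1 - tanh x) = 1 + tanh x := by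
  have hcosh := (cosh_pos x).ne'
  rw [tanh_eq_sinh_div_cosh]
  field_simp
  rw [cosh_sub_sinh, cosh_add_sinh, ← exp_add]
  ring_nf

section Expect

open Classical in
/-- The expectation of a function of the graph in the degree-corrected two-star model. -/
noncomputable def expect {n : ℕ} (θ : ℝ) (β : Fin n → ℝ) (f : SimpleGraph (Fin n) → ℝ) : ℝ :=
  ∑ G : SimpleGraph (Fin n), mass θ β G * f G

variable {n : ℕ} {θ : ℝ} {β : Fin n → ℝ} {f g : SimpleGraph (Fin n) → ℝ}

theorem weight_pos (θ : ℝ) (β : Fin n → ℝ) (G : SimpleGraph (Fin n)) : 0 < weight θ β G :=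
  exp_pos _

theorem partitionFunction_pos (θ : ℝ) (β : Fin n → ℝ) : 0 < partitionFunction θ β := by
  classical
  exact Finset.sum_pos (fun G _ => weight_pos θ β G) Finset.univ_nonempty

theorem mass_pos (θ : ℝ) (β : Fin n → ℝ) (G : SimpleGraph (Fin n)) : 0 < mass θ β G :=
  div_pos (weight_pos θ β G) (partitionFunction_pos θ β)

theorem expect_const (θ : ℝ) (β : Fin n → ℝ) (c : ℝ) : expect θ β (fun _ => c) = c := by
  simp only [expect, mass, ← Finset.sum_mul, ← Finset.sum_div]
  change partitionFunction θ β / partitionFunction θ β * c = c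
  rw [div_self (partitionFunction_pos θ β).ne', one_mul]

theorem expect_add (θ : ℝ) (β : Fin n → ℝ) (f g : SimpleGraph (Fin n) → ℝ) :
    expect θ β (fun G => f G + g G) = expect θ β f + expect θ β g := by
  simp only [expect, mul_add, Finset.sum_add_distrib]

theorem expect_sub (θ : ℝ) (β : Fin n → ℝ) (f g : SimpleGraph (Fin n) → ℝ) :
    expect θ β (fun G => f G - g G) = expect θ β f - expect θ β g := by
  simp only [expect, mul_sub, Finset.sum_sub_distrib]

theorem expect_neg (θ : ℝ) (β : Fin n → ℝ) (f : SimpleGraph (Fin n) → ℝ) :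
    expect θ β (fun G => -f G) = -expect θ β f := by
  simp only [expect, mul_neg, Finset.sum_neg_distrib]

theorem expect_const_mul (θ : ℝ) (β : Fin n → ℝ) (c : ℝ) (f : SimpleGraph (Fin n) → ℝ) :
    expect θ β (fun G => c * f G) = c * expect θ β f := by
  simp only [expect, mul_left_comm _ c, ← Finset.mul_sum]

theorem expect_sum {ι : Type*} (θ : ℝ) (β : Fin n → ℝ) (s : Finset ι)
    (f : ι → SimpleGraph (Fin n) → ℝ) :
    expect θ β (fun G => ∑ i ∈ s, f i G) = ∑ i ∈ s, expect θ β (f i) := by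
  simp only [expect, Finset.mul_sum]
  exact Finset.sum_comm

theorem expect_mono (h : ∀ G, f G ≤ g G) : expect θ β f ≤ expect θ β g :=
  Finset.sum_le_sum fun G _ => mul_le_mul_of_nonneg_left (h G) (mass_pos θ β G).le

theorem exp_expect_le (θ : ℝ) (β : Fin n → ℝ) (f : SimpleGraph (Fin n) → ℝ) :
    exp (expect θ β f) ≤ expect θ β fun G => exp (f G) := by
  set m := expect θ β f with hm
  calc exp m = expect θ β fun G => exp m * (f G - m + 1) := by
        rw [expect_const_mul, expect_add, expect_sub, expect_const, expect_const, ← hm, sub_self,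
          zero_add, mul_one]
    _ ≤ expect θ β fun G => exp (f G) := expect_mono fun G => by
        rw [← add_sub_cancel m (f G), exp_add, add_sub_cancel]
        exact mul_le_mul_of_nonneg_left (add_one_le_exp _) (exp_pos m).le

theorem expect_eq_zero_of_involutive {φ : SimpleGraph (Fin n) → SimpleGraph (Fin n)}
    (hφ : φ.Involutive) (h : ∀ G, mass θ β G * f G + mass θ β (φ G) * f (φ G) = 0) :
    expect θ β f = 0 := by
  have hsum : expect θ β f + expect θ β f = 0 := by
    nth_rw 2 [expect]
    rw [← Equiv.sum_comp hφ.toPerm, expect, ← Finset.sum_add_distrib]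
    exact Finset.sum_eq_zero fun G _ => h G
  linarith

theorem prob_eq_expect (θ : ℝ) (β : Fin n → ℝ) (E : Set (SimpleGraph (Fin n))) :
    prob θ β E = expect θ β (E.indicator 1) := by
  refine Finset.sum_congr rfl fun G _ => ?_
  by_cases h : G ∈ E <;> simp [h]

theorem prob_nonneg (θ : ℝ) (β : Fin n → ℝ) (E : Set (SimpleGraph (Fin n))) : 0 ≤ prob θ β E := by
  refine Finset.sum_nonneg fun G _ => ?_
  split_ifs
  exacts [(mass_pos θ β G).le, le_rfl]

theorem prob_le_expect {E : Set (SimpleGraph (Fin n))} (hf : ∀ G, 0 ≤ f G)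
    (hE : ∀ G ∈ E, 1 ≤ f G) : prob θ β E ≤ expect θ β f := by
  rw [prob_eq_expect]
  exact expect_mono <| Set.indicator_le' hE fun G _ => hf G

theorem prob_le_one (θ : ℝ) (β : Fin n → ℝ) (E : Set (SimpleGraph (Fin n))) : prob θ β E ≤ 1 :=
  (prob_le_expect (f := fun _ => 1) (by simp) (by simp)).trans_eq (expect_const θ β 1)

end Expect

section Tilt

variable {n : ℕ} {θ : ℝ} {β : Fin n → ℝ}

theorem weight_add (θ : ℝ) (β δ : Fin n → ℝ) (G : SimpleGraph (Fin n)) :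
    weight θ (β + δ) G = weight θ β G * exp (1 / 2 * δ ⬝ᵥ deg G) := by
  change exp (_ + 1 / 2 * (β + δ) ⬝ᵥ deg G) = exp (_ + 1 / 2 * β ⬝ᵥ deg G) * _
  rw [← exp_add, add_dotProduct]
  ring_nf

theorem partitionFunction_mul_expect_exp_mul (θ : ℝ) (β δ : Fin n → ℝ)
    (f : SimpleGraph (Fin n) → ℝ) :
    partitionFunction θ β * expect θ β (fun G => exp (1 / 2 * δ ⬝ᵥ deg G) * f G) =
      partitionFunction θ (β + δ) * expect θ (β + δ) f := by
  have h₀ := (partitionFunction_pos θ β).ne'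
  have h₁ := (partitionFunction_pos θ (β + δ)).ne'
  simp only [expect, Finset.mul_sum, mass, weight_add]
  refine Finset.sum_congr rfl fun G _ => ?_
  field_simp

theorem partitionFunction_mul_expect_exp (θ : ℝ) (β δ : Fin n → ℝ) :
    partitionFunction θ β * expect θ β (fun G => exp (1 / 2 * δ ⬝ᵥ deg G)) =
      partitionFunction θ (β + δ) := by
  simpa only [mul_one, expect_const] using
    partitionFunction_mul_expect_exp_mul θ β δ fun _ => 1

/-- The vector of mean degrees. -/
noncomputable def meanDeg {n : ℕ} (θ : ℝ) (β : Fin n → ℝ) (i : Fin n) : ℝ :=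
  expect θ β fun G => deg G i

theorem expect_dotProduct_deg (θ : ℝ) (β δ : Fin n → ℝ) :
    expect θ β (fun G => δ ⬝ᵥ deg G) = δ ⬝ᵥ meanDeg θ β := by
  simp only [dotProduct, expect_sum, expect_const_mul, meanDeg]

theorem partitionFunction_mul_exp_le (θ : ℝ) (β δ : Fin n → ℝ) :
    partitionFunction θ β * exp (1 / 2 * δ ⬝ᵥ meanDeg θ β) ≤ partitionFunction θ (β + δ) := by
  rw [← partitionFunction_mul_expect_exp, ← expect_dotProduct_deg, ← expect_const_mul]
  exact mul_le_mul_of_nonneg_left (exp_expect_le _ _ _) (partitionFunction_pos θ β).le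

theorem expect_exp_sub_meanDeg_le (θ : ℝ) (β δ : Fin n → ℝ) :
    expect θ β (fun G => exp (1 / 2 * δ ⬝ᵥ (deg G - meanDeg θ β))) ≤
      exp (1 / 2 * δ ⬝ᵥ (meanDeg θ (β + δ) - meanDeg θ β)) := by
  have hZ := partitionFunction_pos θ β
  have hconvex := partitionFunction_mul_exp_le θ (β + δ) (-δ)
  rw [add_neg_cancel_right, ← partitionFunction_mul_expect_exp, mul_assoc,
    mul_le_iff_le_one_right hZ, neg_dotProduct, mul_neg, exp_neg, ← div_eq_mul_inv,
    div_le_one (exp_pos _)] at hconvex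
  calc _ = exp (-(1 / 2 * δ ⬝ᵥ meanDeg θ β)) * expect θ β fun G => exp (1 / 2 * δ ⬝ᵥ deg G) := by
        rw [← expect_const_mul]
        simp only [← exp_add, dotProduct_sub, mul_sub, neg_add_eq_sub]
    _ ≤ exp (-(1 / 2 * δ ⬝ᵥ meanDeg θ β)) * exp (1 / 2 * δ ⬝ᵥ meanDeg θ (β + δ)) := by gcongr
    _ = _ := by
        rw [← exp_add, dotProduct_sub, mul_sub, sub_eq_neg_add]

end Tilt

section Lattice

variable {n : ℕ} {θ : ℝ} {β β' : Fin n → ℝ}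

theorem adj_self (G : SimpleGraph (Fin n)) (i : Fin n) : adj G i i = 0 := if_pos rfl

theorem adj_comm (G : SimpleGraph (Fin n)) (i j : Fin n) : adj G i j = adj G j i := by
  have := G.adj_comm i j
  simp only [adj]
  grind

theorem adj_eq_one_or (G : SimpleGraph (Fin n)) {i j : Fin n} (h : i ≠ j) :
    adj G i j = 1 ∨ adj G i j = -1 := by
  simp only [adj, if_neg h]
  split_ifs <;> simp

theorem adj_mono (i j : Fin n) : Monotone fun G : SimpleGraph (Fin n) => adj G i j := by
  intro G H h
  have := @h i j
  simp only [adj]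
  split_ifs <;> first | (norm_num; done) | (exfalso; tauto)

theorem deg_mono (i : Fin n) : Monotone fun G : SimpleGraph (Fin n) => deg G i :=
  fun _ _ h => Finset.sum_le_sum fun j _ => adj_mono i j h

theorem dotProduct_deg_mono (hβ : 0 ≤ β) : Monotone fun G : SimpleGraph (Fin n) => β ⬝ᵥ deg G :=
  fun _ _ h => dotProduct_le_dotProduct_of_nonneg_left (fun i => deg_mono i h) hβ

theorem adj_inf (G H : SimpleGraph (Fin n)) (i j : Fin n) :
    adj (G ⊓ H) i j = min (adj G i j) (adj H i j) := by
  have := SimpleGraph.inf_adj G H i j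
  simp only [adj]
  split_ifs <;> first | (norm_num; done) | (exfalso; tauto)

theorem adj_sup (G H : SimpleGraph (Fin n)) (i j : Fin n) :
    adj (G ⊔ H) i j = max (adj G i j) (adj H i j) := by
  have := SimpleGraph.sup_adj G H i j
  simp only [adj]
  split_ifs <;> first | (norm_num; done) | (exfalso; tauto)

theorem deg_inf_add_deg_sup (G H : SimpleGraph (Fin n)) :
    deg (G ⊓ H) + deg (G ⊔ H) = deg G + deg H := by
  funext i
  simp only [deg, Pi.add_apply, ← Finset.sum_add_distrib, adj_inf, adj_sup, min_add_max]

theorem mul_add_mul_le_min_mul_min_add_max_mul_max (a b c d : ℝ) :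
    a * b + c * d ≤ min a c * min b d + max a c * max b d := by
  rcases le_total a c with h | h <;> rcases le_total b d with h' | h' <;>
    simp only [min_eq_left, min_eq_right, max_eq_left, max_eq_right, h, h'] <;> nlinarith

theorem twoStars_supermodular (G H : SimpleGraph (Fin n)) :
    twoStars G + twoStars H ≤ twoStars (G ⊓ H) + twoStars (G ⊔ H) := by
  simp only [twoStars, ← Finset.sum_add_distrib, adj_inf, adj_sup]
  refine Finset.sum_le_sum fun i _ => Finset.sum_le_sum fun j _ => Finset.sum_le_sum fun k _ => ?_
  exact mul_add_mul_le_min_mul_min_add_max_mul_max _ _ _ _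

theorem weight_log_supermodular (hθ : 0 ≤ θ) (β : Fin n → ℝ) (G H : SimpleGraph (Fin n)) :
    weight θ β G * weight θ β H ≤ weight θ β (G ⊓ H) * weight θ β (G ⊔ H) := by
  rcases n.eq_zero_or_pos with rfl | hn
  · rw [Subsingleton.elim H G, inf_idem, sup_idem]
  have hcoupling : 0 ≤ θ / ((n : ℝ) - 1) := div_nonneg hθ <| by
    rw [sub_nonneg]
    exact_mod_cast hn
  have hlinear : β ⬝ᵥ deg (G ⊓ H) + β ⬝ᵥ deg (G ⊔ H) = β ⬝ᵥ deg G + β ⬝ᵥ deg H := by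
    rw [← dotProduct_add, deg_inf_add_deg_sup, dotProduct_add]
  simp only [weight, ← exp_add, exp_le_exp]
  simp only [dotProduct] at hlinear
  linarith [mul_le_mul_of_nonneg_left (twoStars_supermodular G H) hcoupling]

theorem expect_mul_expect_le (hθ : 0 ≤ θ) {f g : SimpleGraph (Fin n) → ℝ} (hf : Monotone f)
    (hg : Monotone g) : expect θ β f * expect θ β g ≤ expect θ β fun G => f G * g G := by
  classical
  have hsub {h : SimpleGraph (Fin n) → ℝ} (hh : Monotone h) : 0 ≤ fun G => h G - h ⊥ :=
    fun _ => sub_nonneg.2 (hh bot_le)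
  have hmass (G H) : mass θ β G * mass θ β H ≤ mass θ β (G ⊓ H) * mass θ β (G ⊔ H) := by
    have hZ := partitionFunction_pos θ β
    simp only [mass, div_mul_div_comm]
    gcongr ?_ / _
    exact weight_log_supermodular hθ β G H
  have hfkg : expect θ β (fun G => f G - f ⊥) * expect θ β (fun G => g G - g ⊥) ≤
      expect θ β (fun _ => 1) * expect θ β (fun G => (f G - f ⊥) * (g G - g ⊥)) := by
    simp only [expect, mul_one]
    convert fkg _ _ (mass θ β) (fun G => (mass_pos θ β G).le) (hsub hf) (hsub hg)
      (fun _ _ h => sub_le_sub_right (hf h) _) (fun _ _ h => sub_le_sub_right (hg h) _) hmass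
  have hexpand (G) : (f G - f ⊥) * (g G - g ⊥) =
      f G * g G - g ⊥ * f G - (f ⊥ * g G - f ⊥ * g ⊥) := by ring
  simp only [hexpand, expect_sub, expect_const_mul, expect_const] at hfkg
  linarith

theorem expect_mono_field (hθ : 0 ≤ θ) (hβ : β ≤ β') {f : SimpleGraph (Fin n) → ℝ}
    (hf : Monotone f) : expect θ β f ≤ expect θ β' f := by
  obtain ⟨δ, hδ, rfl⟩ := exists_nonneg_add_of_le hβ
  have hexp : Monotone fun G : SimpleGraph (Fin n) => exp (1 / 2 * δ ⬝ᵥ deg G) :=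
    exp_monotone.comp ((dotProduct_deg_mono hδ).const_mul (by norm_num))
  have hcorr := mul_le_mul_of_nonneg_left (expect_mul_expect_le (β := β) hθ hexp hf)
    (partitionFunction_pos θ β).le
  rw [partitionFunction_mul_expect_exp_mul, ← mul_assoc, partitionFunction_mul_expect_exp] at hcorr
  exact le_of_mul_le_mul_left hcorr (partitionFunction_pos θ (β + δ))

theorem prob_anti_field (hθ : 0 ≤ θ) (hβ : β ≤ β') {E : Set (SimpleGraph (Fin n))}
    (hE : IsLowerSet E) : prob θ β' E ≤ prob θ β E := by
  have hmono : Monotone fun G => -E.indicator (1 : SimpleGraph (Fin n) → ℝ) G := by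
    intro G H hGH
    by_cases hH : H ∈ E
    · simp [hH, hE hGH hH]
    · simpa only [Set.indicator_of_notMem hH, neg_zero, neg_nonpos] using
        Set.indicator_nonneg (f := 1) (fun _ _ => zero_le_one) G
  simpa only [prob_eq_expect, expect_neg, neg_le_neg_iff] using expect_mono_field hθ hβ hmono

end Lattice

section Toggle

variable {n : ℕ} {θ : ℝ} {β : Fin n → ℝ} {i j : Fin n}

theorem two_mul_sum_sum_Ioi_mul (a : Fin n → ℝ) :
    2 * ∑ j, ∑ k ∈ Finset.Ioi j, a j * a k = (∑ j, a j) * ∑ j, a j - ∑ j, a j * a j := by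
  have hcomm (j k) : a j * a k + a k * a j = 2 * (a j * a k) := by ring
  have hcompl (j) : ∑ k ∈ {j}ᶜ, a k = ∑ k, a k - a j := by
    rw [eq_sub_iff_add_eq, ← Finset.sum_compl_add_sum {j}, Finset.sum_singleton]
  have hoff := Finset.sum_sum_Ioi_add_eq_sum_sum_off_diag fun j k => a k * a j
  simp only [hcomm, ← Finset.mul_sum, hcompl] at hoff ⊢
  rw [hoff, Finset.sum_mul, ← Finset.sum_sub_distrib]
  simp only [mul_sub]

theorem sum_adj_mul_adj (G : SimpleGraph (Fin n)) (i : Fin n) :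
    ∑ j, adj G i j * adj G i j = n - 1 := by
  have hsq (j) : adj G i j * adj G i j = 1 - if i = j then 1 else 0 := by
    split_ifs with h
    · simp [h, adj_self]
    · rcases adj_eq_one_or G h with hij | hij <;> simp [hij]
  simp [hsq]

theorem two_mul_twoStars (G : SimpleGraph (Fin n)) :
    2 * twoStars G = deg G ⬝ᵥ deg G - n * (n - 1) := by
  rw [twoStars, Finset.mul_sum]
  simp only [two_mul_sum_sum_Ioi_mul, sum_adj_mul_adj, Finset.sum_sub_distrib, deg, dotProduct]
  simp [mul_sub]

/-- The graph in which the pair `i j` has been switched between edge and non-edge. -/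
def toggle (i j : Fin n) (G : SimpleGraph (Fin n)) : SimpleGraph (Fin n) :=
  symmDiff (SimpleGraph.edge i j) G

theorem toggle_involutive (i j : Fin n) : Function.Involutive (toggle i j) :=
  symmDiff_right_involutive _

theorem adj_toggle (i j : Fin n) (G : SimpleGraph (Fin n)) (u v : Fin n) :
    adj (toggle i j G) u v = if s(u, v) = s(i, j) then -adj G u v else adj G u v := by
  have htoggle : (toggle i j G).Adj u v ↔ u ≠ v ∧ (G.Adj u v ↔ s(u, v) ≠ s(i, j)) := by
    have hne : G.Adj u v → u ≠ v := SimpleGraph.Adj.ne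
    simp only [toggle, symmDiff, SimpleGraph.sup_adj, SimpleGraph.sdiff_adj,
      SimpleGraph.edge_adj, ne_eq, Sym2.eq_iff]
    tauto
  simp only [adj]
  grind

theorem deg_toggle (hij : i ≠ j) (G : SimpleGraph (Fin n)) :
    deg (toggle i j G) = deg G - (2 * adj G i j) • (Pi.single i 1 + Pi.single j 1) := by
  funext u
  have hadj (v : Fin n) : adj (toggle i j G) u v = adj G u v - 2 * adj G i j *
      ((Pi.single i 1 : Fin n → ℝ) u * (Pi.single j 1 : Fin n → ℝ) v +
        (Pi.single j 1 : Fin n → ℝ) u * (Pi.single i 1 : Fin n → ℝ) v) := by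
    rw [adj_toggle]
    have := adj_comm G i j
    simp only [Pi.single_apply, Sym2.eq_iff]
    grind
  simp [deg, hadj, Finset.sum_sub_distrib, ← Finset.mul_sum, Finset.sum_add_distrib, mul_add]

theorem deg_sub_deg_toggle_dotProduct_self (hij : i ≠ j) (G : SimpleGraph (Fin n)) :
    deg G ⬝ᵥ deg G - deg (toggle i j G) ⬝ᵥ deg (toggle i j G) =
      4 * adj G i j * (deg G i + deg G j - 2 * adj G i j) := by
  rw [deg_toggle hij]
  simp only [smul_add, dotProduct_sub, sub_dotProduct, add_dotProduct, smul_dotProduct,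
    single_dotProduct, one_mul, smul_eq_mul, dotProduct_add, dotProduct_smul, dotProduct_single,
    Pi.sub_apply, Pi.add_apply, Pi.smul_apply, Pi.single_eq_same, mul_one, ne_eq, hij,
    not_false_eq_true, Pi.single_eq_of_ne, mul_zero, add_zero, hij.symm, zero_add]
  ring

/-- The local field felt by the pair `i j`: half the change of the log-weight when the pair is
switched from non-edge to edge. -/
noncomputable def localField (θ : ℝ) (β : Fin n → ℝ) (i j : Fin n) (G : SimpleGraph (Fin n)) : ℝ :=
  θ / ((n : ℝ) - 1) * (deg G i + deg G j - 2 * adj G i j) + (β i + β j) / 2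

theorem adj_toggle_self (i j : Fin n) (G : SimpleGraph (Fin n)) :
    adj (toggle i j G) i j = -adj G i j := by
  rw [adj_toggle, if_pos rfl]

theorem localField_toggle (hij : i ≠ j) (θ : ℝ) (β : Fin n → ℝ) (G : SimpleGraph (Fin n)) :
    localField θ β i j (toggle i j G) = localField θ β i j G := by
  have hdeg : deg (toggle i j G) i + deg (toggle i j G) j + 2 * adj G i j =
      deg G i + deg G j - 2 * adj G i j := by
    rw [deg_toggle hij]
    simp only [smul_add, Pi.sub_apply, Pi.add_apply, Pi.smul_apply, Pi.single_eq_same,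
      smul_eq_mul, mul_one, ne_eq, hij, not_false_eq_true, Pi.single_eq_of_ne, mul_zero, add_zero,
      hij.symm, zero_add]
    ring
  rw [localField, adj_toggle_self, mul_neg, sub_neg_eq_add, hdeg, localField]

theorem weight_eq_weight_toggle_mul (hij : i ≠ j) (θ : ℝ) (β : Fin n → ℝ)
    (G : SimpleGraph (Fin n)) :
    weight θ β G = weight θ β (toggle i j G) * exp (2 * (adj G i j * localField θ β i j G)) := by
  have hstar := deg_sub_deg_toggle_dotProduct_self hij G
  have hG := two_mul_twoStars G
  have htoggle := two_mul_twoStars (toggle i j G)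
  have hlinear : β ⬝ᵥ deg G - β ⬝ᵥ deg (toggle i j G) = 2 * adj G i j * (β i + β j) := by
    rw [deg_toggle hij]
    simp [dotProduct_sub, dotProduct_add, mul_add]
  rw [weight, weight, ← exp_add, localField]
  change exp (_ + 1 / 2 * β ⬝ᵥ deg G) = exp (_ + 1 / 2 * β ⬝ᵥ deg (toggle i j G) + _)
  congr 1
  linear_combination hlinear / 2 + θ / (n - 1) / 2 * (hG - htoggle + hstar)

/-- Given all other pairs, the conditional mean of `Y_ij` is the hyperbolic tangent of its local
field. -/
theorem expect_adj (hij : i ≠ j) (θ : ℝ) (β : Fin n → ℝ) :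
    expect θ β (fun G => adj G i j) = expect θ β fun G => tanh (localField θ β i j G) := by
  rw [← sub_eq_zero, ← expect_sub]
  refine expect_eq_zero_of_involutive (toggle_involutive i j) fun G => ?_
  have hexp := exp_two_mul_mul_one_sub_tanh (adj G i j * localField θ β i j G)
  rw [localField_toggle hij, adj_toggle_self, mass, mass, weight_eq_weight_toggle_mul hij θ β G]
  rcases adj_eq_one_or G hij with h | h <;> rw [h] at hexp ⊢
  · rw [one_mul] at hexp ⊢
    linear_combination weight θ β (toggle i j G) / partitionFunction θ β * hexp
  · rw [neg_one_mul, tanh_neg] at hexp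
    rw [neg_one_mul]
    linear_combination -weight θ β (toggle i j G) / partitionFunction θ β * hexp

end Toggle

section MeanDeg

variable {n : ℕ} {θ : ℝ} {β δ : Fin n → ℝ}

theorem deg_eq_sum_erase (G : SimpleGraph (Fin n)) (i : Fin n) :
    deg G i = ∑ j ∈ Finset.univ.erase i, adj G i j := by
  rw [deg, Finset.sum_erase _ (adj_self G i)]

theorem meanDeg_eq_sum_expect_tanh (θ : ℝ) (β : Fin n → ℝ) (i : Fin n) :
    meanDeg θ β i =
      ∑ j ∈ Finset.univ.erase i, expect θ β fun G => tanh (localField θ β i j G) := by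
  simp only [meanDeg, deg_eq_sum_erase, expect_sum]
  exact Finset.sum_congr rfl fun j hj => expect_adj (Finset.ne_of_mem_erase hj).symm θ β

theorem sum_erase_localField (θ : ℝ) (β : Fin n → ℝ) (i : Fin n) (G : SimpleGraph (Fin n)) :
    ∑ j ∈ Finset.univ.erase i, localField θ β i j G =
      θ / ((n : ℝ) - 1) * ((n - 4) * deg G i + ∑ j, deg G j) +
        ((n - 2) * β i + ∑ j, β j) / 2 := by
  have hadj : ∑ j, adj G i j = deg G i := rfl
  simp only [localField, Finset.sum_erase_eq_sub (Finset.mem_univ i), Finset.sum_add_distrib,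
    ← Finset.mul_sum, ← Finset.sum_div, Finset.sum_sub_distrib, hadj, Finset.sum_const,
    Finset.card_univ, Fintype.card_fin, nsmul_eq_mul, adj_self]
  ring

theorem sum_erase_expect_localField (θ : ℝ) (β : Fin n → ℝ) (i : Fin n) :
    ∑ j ∈ Finset.univ.erase i, expect θ β (localField θ β i j) =
      θ / ((n : ℝ) - 1) * ((n - 4) * meanDeg θ β i + ∑ j, meanDeg θ β j) +
        ((n - 2) * β i + ∑ j, β j) / 2 := by
  rw [← expect_sum]
  simp only [sum_erase_localField, expect_add, expect_const_mul, expect_sum, expect_const, meanDeg]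

theorem deg_sub_adj_mono (i j : Fin n) :
    Monotone fun G : SimpleGraph (Fin n) => deg G i - adj G i j := by
  intro G H h
  simp only [deg, ← Finset.sum_erase_eq_sub (Finset.mem_univ j)]
  exact Finset.sum_le_sum fun k _ => adj_mono i k h

theorem localField_mono (hθ : 0 ≤ θ) (β : Fin n → ℝ) (i j : Fin n) :
    Monotone (localField θ β i j) := by
  intro G H h
  have hcoupling : 0 ≤ θ / ((n : ℝ) - 1) := div_nonneg hθ <| by
    rw [sub_nonneg]
    exact_mod_cast i.pos
  have hi := deg_sub_adj_mono i j h
  have hj := deg_sub_adj_mono j i h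
  simp only [adj_comm _ j i] at hj
  unfold localField
  gcongr ?_ * ?_ + _
  linarith

theorem meanDeg_mono (hθ : 0 ≤ θ) : Monotone (meanDeg (n := n) θ) :=
  fun _ _ h i => expect_mono_field hθ h (deg_mono i)

/-- By monotonicity of `x - tanh x`, the mean degrees grow at most as fast as if each pair
responded linearly to its local field. -/
theorem meanDeg_add_sub_meanDeg_le_linear (hθ : 0 ≤ θ) (hδ : 0 ≤ δ) (i : Fin n) :
    (meanDeg θ (β + δ) - meanDeg θ β) i ≤
      θ / ((n : ℝ) - 1) * ((n - 4) * (meanDeg θ (β + δ) - meanDeg θ β) i +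
        ∑ j, (meanDeg θ (β + δ) - meanDeg θ β) j) + ((n - 2) * δ i + ∑ j, δ j) / 2 := by
  have hpair (j) : expect θ β (fun G => localField θ β i j G - tanh (localField θ β i j G)) ≤
      expect θ (β + δ) fun G =>
        localField θ (β + δ) i j G - tanh (localField θ (β + δ) i j G) := by
    refine (expect_mono_field hθ (le_add_of_nonneg_right hδ) fun G H h =>
      monotone_sub_tanh (localField_mono hθ β i j h)).trans
        (expect_mono fun G => monotone_sub_tanh ?_)
    simp only [localField, Pi.add_apply]
    have hi : 0 ≤ δ i := hδ i
    have hj : 0 ≤ δ j := hδ j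
    linarith
  have hsum := Finset.sum_le_sum fun j (_ : j ∈ Finset.univ.erase i) => hpair j
  simp only [expect_sub, Finset.sum_sub_distrib, ← meanDeg_eq_sum_expect_tanh,
    sum_erase_expect_localField, Pi.add_apply, Finset.sum_add_distrib] at hsum
  simp only [Pi.sub_apply, Finset.sum_sub_distrib]
  linarith

theorem sum_meanDeg_add_sub_meanDeg_le (hn : 2 ≤ n) (hθ₀ : 0 ≤ θ) (hθ : θ ≤ 1 / 2) (hδ : 0 ≤ δ) :
    ∑ i, (meanDeg θ (β + δ) - meanDeg θ β) i ≤ ((n : ℝ) - 1) ^ 2 * ∑ i, δ i := by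
  have hN := one_le_natCast_sub_one hn
  set D := meanDeg θ (β + δ) - meanDeg θ β
  have hD : 0 ≤ ∑ i, D i := Finset.sum_nonneg fun i _ =>
    sub_nonneg.2 (meanDeg_mono hθ₀ (le_add_of_nonneg_right hδ) i)
  have hsum := Finset.sum_le_sum fun i (_ : i ∈ Finset.univ) =>
    meanDeg_add_sub_meanDeg_le_linear (β := β) hθ₀ hδ i
  simp only [Finset.sum_add_distrib, ← Finset.mul_sum, ← Finset.sum_div, Finset.sum_const,
    Finset.card_univ, Fintype.card_fin, nsmul_eq_mul] at hsum
  have hscale : θ / ((n : ℝ) - 1) * ((n - 4) * ∑ i, D i + n * ∑ i, D i) ≤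
      ∑ i, D i - (∑ i, D i) / (n - 1) := by
    calc θ / ((n : ℝ) - 1) * ((n - 4) * ∑ i, D i + n * ∑ i, D i)
        = θ * (2 * (n - 1 - 1) * (∑ i, D i) / (n - 1)) := by ring
      _ ≤ 1 / 2 * (2 * (n - 1 - 1) * (∑ i, D i) / (n - 1)) := by
        refine mul_le_mul_of_nonneg_right hθ (div_nonneg (mul_nonneg ?_ hD) ?_) <;> linarith
      _ = ∑ i, D i - (∑ i, D i) / (n - 1) := by
        field_simp
  have hdiv : (∑ i, D i) / (n - 1) ≤ (n - 1) * ∑ i, δ i := by linarith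
  rw [div_le_iff₀ (by linarith)] at hdiv
  linarith

theorem meanDeg_add_sub_meanDeg_le (hn : 2 ≤ n) (hθ₀ : 0 ≤ θ) (hθ : θ ≤ 1 / 2) (hδ : 0 ≤ δ)
    (i : Fin n) :
    (meanDeg θ (β + δ) - meanDeg θ β) i ≤
      (∑ j, (meanDeg θ (β + δ) - meanDeg θ β) j) / ((n : ℝ) - 1) + (n - 2) * δ i + ∑ j, δ j := by
  have hN := one_le_natCast_sub_one hn
  have hlinear := meanDeg_add_sub_meanDeg_le_linear (β := β) hθ₀ hδ i
  have hD : 0 ≤ meanDeg θ (β + δ) - meanDeg θ β :=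
    sub_nonneg.2 (meanDeg_mono hθ₀ (le_add_of_nonneg_right hδ))
  set D := meanDeg θ (β + δ) - meanDeg θ β
  have hDi : 0 ≤ D i := hD i
  have hsum : 0 ≤ ∑ j, D j := Finset.sum_nonneg fun j _ => hD j
  have hscale : θ / ((n : ℝ) - 1) * ((n - 4) * D i + ∑ j, D j) ≤
      D i / 2 + (∑ j, D j) / (n - 1) / 2 := by
    calc θ / ((n : ℝ) - 1) * ((n - 4) * D i + ∑ j, D j)
        ≤ 1 / 2 / (n - 1) * ((n - 1) * D i + ∑ j, D j) := by
          have hcoupling : θ / ((n : ℝ) - 1) ≤ 1 / 2 / (n - 1) :=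
            div_le_div_of_nonneg_right hθ (by linarith)
          refine mul_le_mul_of_nonneg hcoupling (by linarith) (div_nonneg hθ₀ (by linarith)) ?_
          exact add_nonneg (mul_nonneg (by linarith) hDi) hsum
      _ = D i / 2 + (∑ j, D j) / (n - 1) / 2 := by
        field_simp
  linarith

theorem dotProduct_meanDeg_add_sub_meanDeg_le (hn : 2 ≤ n) (hθ₀ : 0 ≤ θ) (hθ : θ ≤ 1 / 2)
    (hδ : 0 ≤ δ) :
    δ ⬝ᵥ (meanDeg θ (β + δ) - meanDeg θ β) ≤ 2 * n * (∑ i, δ i) ^ 2 := by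
  have hN := one_le_natCast_sub_one hn
  have hsum := sum_meanDeg_add_sub_meanDeg_le (β := β) hn hθ₀ hθ hδ
  rw [sq, mul_assoc, ← div_le_iff₀' (by linarith)] at hsum
  have hpoint (i) : (meanDeg θ (β + δ) - meanDeg θ β) i ≤ 2 * n * ∑ j, δ j := by
    have hi := meanDeg_add_sub_meanDeg_le (β := β) hn hθ₀ hθ hδ i
    have hle : ((n : ℝ) - 2) * δ i ≤ (n - 2) * ∑ j, δ j := by
      gcongr
      · linarith
      · exact Finset.single_le_sum (fun j _ => hδ j) (Finset.mem_univ i)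
    have hδsum : 0 ≤ ∑ j, δ j := Finset.sum_nonneg fun j _ => hδ j
    linarith
  calc δ ⬝ᵥ (meanDeg θ (β + δ) - meanDeg θ β) ≤ ∑ i, δ i * (2 * n * ∑ j, δ j) :=
        Finset.sum_le_sum fun i _ => mul_le_mul_of_nonneg_left (hpoint i) (hδ i)
    _ = 2 * n * (∑ i, δ i) ^ 2 := by
        rw [← Finset.sum_mul]
        ring

theorem adj_compl (G : SimpleGraph (Fin n)) (i j : Fin n) : adj Gᶜ i j = -adj G i j := by
  have := G.compl_adj i j
  simp only [adj]
  grind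

theorem mass_zero_compl (θ : ℝ) (G : SimpleGraph (Fin n)) : mass θ 0 Gᶜ = mass θ 0 G := by
  simp [mass, weight, twoStars, adj_compl]

theorem meanDeg_zero (θ : ℝ) : meanDeg θ (0 : Fin n → ℝ) = 0 := by
  funext i
  refine expect_eq_zero_of_involutive compl_involutive fun G => ?_
  simp [mass_zero_compl, deg, adj_compl]

theorem meanDeg_nonneg (hθ : 0 ≤ θ) (hβ : 0 ≤ β) : 0 ≤ meanDeg θ β :=
  (meanDeg_zero θ).symm.trans_le (meanDeg_mono hθ hβ)

theorem meanDeg_le (hn : 2 ≤ n) (hθ₀ : 0 ≤ θ) (hθ : θ ≤ 1 / 2) (hβ : 0 ≤ β) (i : Fin n) :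
    meanDeg θ β i ≤ (∑ j, meanDeg θ β j) / ((n : ℝ) - 1) + (n - 2) * β i + ∑ j, β j := by
  simpa [meanDeg_zero] using meanDeg_add_sub_meanDeg_le (β := 0) hn hθ₀ hθ hβ i

theorem expect_exp_deg_sub_meanDeg_le (hn : 2 ≤ n) (hθ₀ : 0 ≤ θ) (hθ : θ ≤ 1 / 2)
    (β : Fin n → ℝ) (hδ : 0 ≤ δ) :
    expect θ β (fun G => exp (1 / 2 * δ ⬝ᵥ (deg G - meanDeg θ β))) ≤
      exp (n * (∑ i, δ i) ^ 2) := by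
  refine (expect_exp_sub_meanDeg_le θ β δ).trans (exp_le_exp.2 ?_)
  linarith [dotProduct_meanDeg_add_sub_meanDeg_le (β := β) hn hθ₀ hθ hδ]

theorem expect_exp_meanDeg_sub_deg_le (hn : 2 ≤ n) (hθ₀ : 0 ≤ θ) (hθ : θ ≤ 1 / 2)
    (β : Fin n → ℝ) (hδ : 0 ≤ δ) :
    expect θ β (fun G => exp (1 / 2 * δ ⬝ᵥ (meanDeg θ β - deg G))) ≤
      exp (n * (∑ i, δ i) ^ 2) := by
  have htilt := expect_exp_sub_meanDeg_le θ β (-δ)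
  have hgrowth := dotProduct_meanDeg_add_sub_meanDeg_le (β := β + -δ) hn hθ₀ hθ hδ
  simp only [neg_dotProduct, ← dotProduct_neg, neg_sub] at htilt
  rw [neg_add_cancel_right] at hgrowth
  exact htilt.trans (exp_le_exp.2 (by linarith))

end MeanDeg

section LowerBound

theorem sq_sum_sqrt_mul_sqrt_le {ι : Type*} [Fintype ι] [DecidableEq ι] {p q : ι → ℝ}
    (hp : 0 ≤ p) (hq : 0 ≤ q) (hp₁ : ∑ i, p i ≤ 1) (hq₁ : ∑ i, q i ≤ 1) (s : Finset ι) :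
    (∑ i, √(p i) * √(q i)) ^ 2 ≤ 2 * (∑ i ∈ s, p i + ∑ i ∈ sᶜ, q i) := by
  have hle {r : ι → ℝ} (hr : 0 ≤ r) (hr₁ : ∑ i, r i ≤ 1) (u : Finset ι) : √(∑ i ∈ u, r i) ≤ 1 :=
    sqrt_le_one.2 <| (Finset.sum_le_univ_sum_of_nonneg hr).trans hr₁
  have hsplit : ∑ i, √(p i) * √(q i) ≤ √(∑ i ∈ s, p i) + √(∑ i ∈ sᶜ, q i) := by
    rw [← Finset.sum_add_sum_compl s]
    gcongr
    · exact (sum_sqrt_mul_sqrt_le _ hp hq).trans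
        (mul_le_of_le_one_right (sqrt_nonneg _) (hle hq hq₁ _))
    · exact (sum_sqrt_mul_sqrt_le _ hp hq).trans
        (mul_le_of_le_one_left (sqrt_nonneg _) (hle hp hp₁ _))
  calc (∑ i, √(p i) * √(q i)) ^ 2 ≤ (√(∑ i ∈ s, p i) + √(∑ i ∈ sᶜ, q i)) ^ 2 := by gcongr
    _ ≤ 2 * (√(∑ i ∈ s, p i) ^ 2 + √(∑ i ∈ sᶜ, q i) ^ 2) := add_sq_le
    _ = 2 * (∑ i ∈ s, p i + ∑ i ∈ sᶜ, q i) := by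
      rw [sq_sqrt (Finset.sum_nonneg fun i _ => hp i), sq_sqrt (Finset.sum_nonneg fun i _ => hq i)]

variable {n : ℕ} {θ : ℝ} {β δ : Fin n → ℝ}

open Classical in
/-- The Hellinger affinity of the two-star models with fields `β` and `β'`. -/
noncomputable def affinity (θ : ℝ) (β β' : Fin n → ℝ) : ℝ :=
  ∑ G : SimpleGraph (Fin n), √(mass θ β G) * √(mass θ β' G)

theorem affinity_sq_le (θ : ℝ) (β β' : Fin n → ℝ) (E : Set (SimpleGraph (Fin n))) :
    affinity θ β β' ^ 2 ≤ 2 * (prob θ β E + prob θ β' Eᶜ) := by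
  classical
  have hone (β : Fin n → ℝ) : ∑ G, mass θ β G ≤ 1 := by
    simpa [expect] using (expect_const θ β 1).le
  have hprob (β : Fin n → ℝ) (E : Set (SimpleGraph (Fin n))) :
      prob θ β E = ∑ G with G ∈ E, mass θ β G :=
    (Finset.sum_filter _ _).symm
  rw [hprob β, hprob β']
  simp only [Set.mem_compl_iff, ← Finset.compl_filter]
  exact sq_sum_sqrt_mul_sqrt_le (fun G => (mass_pos θ β G).le) (fun G => (mass_pos θ β' G).le)
    (hone β) (hone β') _

theorem affinity_sq_mul (θ : ℝ) (β δ : Fin n → ℝ) :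
    affinity θ β (β + δ) ^ 2 * (partitionFunction θ β * partitionFunction θ (β + δ)) =
      partitionFunction θ (β + (1 / 2 : ℝ) • δ) ^ 2 := by
  have h₀ := partitionFunction_pos θ β
  have h₁ := partitionFunction_pos θ (β + δ)
  have hsqrt (G : SimpleGraph (Fin n)) : √(mass θ β G) * √(mass θ (β + δ) G) =
      weight θ (β + (1 / 2 : ℝ) • δ) G /
        √(partitionFunction θ β * partitionFunction θ (β + δ)) := by
    rw [← sqrt_mul (mass_pos θ β G).le, mass, mass, div_mul_div_comm, sqrt_div' _ (by positivity)]
    congr 1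
    rw [sqrt_eq_iff_mul_self_eq (mul_pos (weight_pos _ _ G) (weight_pos _ _ G)).le
      (weight_pos _ _ G).le]
    rw [weight_add, weight_add, mul_mul_mul_comm, ← exp_add, smul_dotProduct, smul_eq_mul]
    ring_nf
  have haff : affinity θ β (β + δ) = partitionFunction θ (β + (1 / 2 : ℝ) • δ) /
      √(partitionFunction θ β * partitionFunction θ (β + δ)) := by
    simp only [affinity, hsqrt, ← Finset.sum_div, partitionFunction]
  rw [haff, div_pow, sq_sqrt (by positivity), div_mul_cancel₀ _ (by positivity)]

theorem exp_neg_le_affinity_sq (θ : ℝ) (β δ : Fin n → ℝ) :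
    exp (-(1 / 4 * δ ⬝ᵥ (meanDeg θ (β + δ) - meanDeg θ β))) ≤ affinity θ β (β + δ) ^ 2 := by
  have h₀ := partitionFunction_pos θ β
  have h₁ := partitionFunction_pos θ (β + δ)
  have hleft := partitionFunction_mul_exp_le θ β ((1 / 2 : ℝ) • δ)
  have hright := partitionFunction_mul_exp_le θ (β + δ) (-((1 / 2 : ℝ) • δ))
  have hmid : β + δ + -((1 / 2 : ℝ) • δ) = β + (1 / 2 : ℝ) • δ := by module
  rw [hmid] at hright
  have hmul := mul_le_mul hleft hright (by positivity) (partitionFunction_pos _ _).le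
  rw [mul_mul_mul_comm, ← exp_add, ← sq, ← affinity_sq_mul, mul_comm] at hmul
  refine le_of_mul_le_mul_right (hmul.trans_eq' ?_) (mul_pos h₀ h₁)
  simp only [neg_dotProduct, smul_dotProduct, dotProduct_sub, smul_eq_mul]
  ring_nf

theorem exp_neg_le_prob_add_prob_compl (hn : 2 ≤ n) (hθ₀ : 0 ≤ θ) (hθ : θ ≤ 1 / 2)
    (β : Fin n → ℝ) (hδ : 0 ≤ δ) (E : Set (SimpleGraph (Fin n))) :
    exp (-(n * (∑ i, δ i) ^ 2 / 2)) / 2 ≤ prob θ β E + prob θ (β + δ) Eᶜ := by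
  have haffinity := (exp_neg_le_affinity_sq θ β δ).trans (affinity_sq_le θ β (β + δ) E)
  have hexp : exp (-(n * (∑ i, δ i) ^ 2 / 2)) ≤
      exp (-(1 / 4 * δ ⬝ᵥ (meanDeg θ (β + δ) - meanDeg θ β))) :=
    exp_le_exp.2 (by linarith [dotProduct_meanDeg_add_sub_meanDeg_le (β := β) hn hθ₀ hθ hδ])
  linarith

end LowerBound

section Risk

variable {n : ℕ} {θ β₀ s A : ℝ}

theorem risk_nonneg (θ β₀ s A : ℝ) (T : SimpleGraph (Fin n) → Fin 2) : 0 ≤ risk θ β₀ s A T :=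
  add_nonneg (prob_nonneg _ _ _) <|
    sSup_nonneg <| Set.forall_mem_image.2 fun _ _ => prob_nonneg _ _ _

theorem risk_le_two (θ β₀ s A : ℝ) (T : SimpleGraph (Fin n) → Fin 2) : risk θ β₀ s A T ≤ 2 :=
  (add_le_add (prob_le_one _ _ _) <| Real.sSup_le (Set.forall_mem_image.2 fun _ _ =>
    prob_le_one _ _ _) zero_le_one).trans_eq one_add_one_eq_two

theorem prob_add_prob_compl_le_risk {β : Fin n → ℝ} (hβ : β ∈ alternatives n β₀ s A) (θ : ℝ)
    (T : SimpleGraph (Fin n) → Fin 2) :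
    prob θ (fun _ => β₀) {G | T G = 1} + prob θ β {G | T G = 1}ᶜ ≤ risk θ β₀ s A T := by
  have hcompl : {G | T G = 1}ᶜ = {G | T G = 0} := by
    ext G
    change ¬T G = 1 ↔ T G = 0
    omega
  rw [hcompl]
  refine add_le_add le_rfl (le_csSup ⟨1, ?_⟩ (Set.mem_image_of_mem _ hβ))
  exact Set.forall_mem_image.2 fun _ _ => prob_le_one _ _ _

theorem const_add_indicator_mem_alternatives (β₀ : ℝ) (hA : 0 < A) {S : Finset (Fin n)}
    (hs : s ≤ S.card) :
    (fun _ => β₀) + (S : Set (Fin n)).indicator (fun _ => A) ∈ alternatives n β₀ s A := by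
  refine ⟨(S : Set (Fin n)).indicator fun _ => A, fun _ => rfl, ?_, fun i hi => ?_⟩
  · simpa [Set.support_indicator, Function.support_const hA.ne'] using hs
  · rw [Set.indicator_of_mem (Set.support_indicator_subset hi)]

theorem exists_const_add_indicator_le {a : ℝ} (ha : 0 ≤ a) (haA : a ≤ A) {β : Fin n → ℝ}
    (hβ : β ∈ alternatives n β₀ s A) :
    ∃ S : Finset (Fin n), S.card = ⌈s⌉₊ ∧
      (fun _ => β₀) + (S : Set (Fin n)).indicator (fun _ => a) ≤ β := by
  classical
  obtain ⟨μ, hβμ, hcard, hμ⟩ := hβ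
  rw [Set.ncard_eq_toFinset_card'] at hcard
  obtain ⟨S, hS, hScard⟩ := Finset.exists_subset_card_eq (Nat.ceil_le.2 hcard)
  refine ⟨S, hScard, fun i => ?_⟩
  simp only [hβμ i, Pi.add_apply, add_le_add_iff_left, Set.indicator_apply, Finset.mem_coe]
  split_ifs with hi
  · exact haA.trans (hμ i (by simpa using hS hi))
  · by_cases hi₀ : μ i = 0
    · exact hi₀.ge
    · exact (ha.trans haA).trans (hμ i hi₀)

theorem sum_indicator_const (S : Finset (Fin n)) (A : ℝ) :
    ∑ i, (S : Set (Fin n)).indicator (fun _ => A) i = S.card * A := by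
  classical
  simp [Set.indicator_apply]

theorem exp_neg_le_risk (hn : 2 ≤ n) (hθ₀ : 0 ≤ θ) (hθ : θ ≤ 1 / 2) (β₀ : ℝ) (hs : 1 ≤ s)
    (hsn : s ≤ n) (hA : 0 < A) (T : SimpleGraph (Fin n) → Fin 2) :
    exp (-(2 * (s * A * √n) ^ 2)) / 2 ≤ risk θ β₀ s A T := by
  obtain ⟨S, -, hS⟩ := Finset.exists_subset_card_eq (s := (Finset.univ : Finset (Fin n)))
    (n := ⌈s⌉₊) <| by
    rwa [Finset.card_univ, Fintype.card_fin, Nat.ceil_le]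
  have hmem := const_add_indicator_mem_alternatives β₀ hA (hS ▸ Nat.le_ceil s)
  refine le_trans ?_ (prob_add_prob_compl_le_risk hmem θ T)
  refine le_trans ?_ (exp_neg_le_prob_add_prob_compl hn hθ₀ hθ _ (fun i => ?_) _)
  · rw [sum_indicator_const, hS]
    gcongr exp (-?_) / 2
    calc n * (⌈s⌉₊ * A) ^ 2 / 2 ≤ n * (2 * s * A) ^ 2 / 2 := by
          gcongr
          exact Nat.ceil_le_two_mul (by linarith)
      _ = 2 * (s * A * √n) ^ 2 := by
          rw [mul_pow _ √_, sq_sqrt n.cast_nonneg]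
          ring
  · exact Set.indicator_nonneg (fun _ _ => hA.le) i

theorem asympNotPowerful_of_isBoundedUnder {s A : ℕ → ℝ} (hθ₀ : 0 ≤ θ) (hθ : θ ≤ 1 / 2) (β₀ : ℝ)
    (hs : ∀ᶠ n : ℕ in atTop, s n ∈ Set.Icc 1 (n : ℝ)) (hA : ∀ᶠ n in atTop, 0 < A n)
    (hbdd : IsBoundedUnder (· ≤ ·) atTop fun n : ℕ => s n * A n * √n)
    (T : ∀ n, SimpleGraph (Fin n) → Fin 2) : AsympNotPowerful θ β₀ s A T := by
  obtain ⟨C, hC⟩ := hbdd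
  rw [eventually_map] at hC
  have hrisk : ∀ᶠ n : ℕ in atTop, exp (-(2 * C ^ 2)) / 2 ≤ risk θ β₀ (s n) (A n) (T n) := by
    filter_upwards [hs, hA, hC, eventually_ge_atTop 2] with n hsn hAn hCn hn
    refine le_trans ?_ (exp_neg_le_risk hn hθ₀ hθ β₀ hsn.1 hsn.2 hAn (T n))
    have hs₀ := zero_le_one.trans hsn.1
    gcongr
  refine lt_of_lt_of_le (by positivity) (le_liminf_of_le ?_ hrisk)
  exact (isBoundedUnder_of ⟨2, fun n => risk_le_two θ β₀ (s n) (A n) (T n)⟩).isCoboundedUnder_ge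

end Risk

section TotalDegree

variable {n : ℕ} {θ : ℝ} {β : Fin n → ℝ}

theorem natCast_mul_sq_sum_inv_sqrt_pow_three (hn : n ≠ 0) :
    (n : ℝ) * (∑ _ : Fin n, (√n ^ 3)⁻¹) ^ 2 = 1 := by
  have hsqrt : √(n : ℝ) ≠ 0 := by positivity
  have hn' : (n : ℝ) = √n ^ 2 := (sq_sqrt n.cast_nonneg).symm
  rw [Finset.sum_const, Finset.card_univ, Fintype.card_fin, nsmul_eq_mul]
  nth_rw 1 [hn']
  nth_rw 2 [hn']
  field_simp

theorem expect_exp_sum_deg_sub_meanDeg_le (hn : 2 ≤ n) (hθ₀ : 0 ≤ θ) (hθ : θ ≤ 1 / 2)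
    (β : Fin n → ℝ) :
    expect θ β (fun G => exp ((∑ i, deg G i - ∑ i, meanDeg θ β i) / √n ^ 3 / 2)) ≤ exp 1 := by
  have h := expect_exp_deg_sub_meanDeg_le (δ := fun _ => (√n ^ 3)⁻¹) hn hθ₀ hθ β
    fun _ => by positivity
  rw [natCast_mul_sq_sum_inv_sqrt_pow_three (by omega)] at h
  convert h using 5 with G
  simp only [dotProduct, ← Finset.mul_sum, Pi.sub_apply, Finset.sum_sub_distrib]
  ring

theorem expect_exp_sum_meanDeg_sub_deg_le (hn : 2 ≤ n) (hθ₀ : 0 ≤ θ) (hθ : θ ≤ 1 / 2)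
    (β : Fin n → ℝ) :
    expect θ β (fun G => exp ((∑ i, meanDeg θ β i - ∑ i, deg G i) / √n ^ 3 / 2)) ≤ exp 1 := by
  have h := expect_exp_meanDeg_sub_deg_le (δ := fun _ => (√n ^ 3)⁻¹) hn hθ₀ hθ β
    fun _ => by positivity
  rw [natCast_mul_sq_sum_inv_sqrt_pow_three (by omega)] at h
  convert h using 5 with G
  simp only [dotProduct, ← Finset.mul_sum, Pi.sub_apply, Finset.sum_sub_distrib]
  ring

theorem prob_le_exp_sub {f : SimpleGraph (Fin n) → ℝ} {E : Set (SimpleGraph (Fin n))} {a b : ℝ}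
    (hf : expect θ β (fun G => exp (f G)) ≤ exp a) (hE : ∀ G ∈ E, b ≤ f G) :
    prob θ β E ≤ exp (a - b) := by
  calc prob θ β E ≤ expect θ β fun G => exp (-b) * exp (f G) :=
        prob_le_expect (fun _ => by positivity) fun G hG => by
          rw [← exp_add]
          exact one_le_exp (by linarith [hE G hG])
    _ ≤ exp (a - b) := by
        rw [expect_const_mul, sub_eq_neg_add, exp_add]
        gcongr

theorem prob_lt_sum_deg_le (hn : 2 ≤ n) (hθ₀ : 0 ≤ θ) (hθ : θ ≤ 1 / 2) (x : ℝ) :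
    prob θ (0 : Fin n → ℝ) {G | x * √n ^ 3 < ∑ i, deg G i} ≤ exp (1 - x / 2) := by
  refine prob_le_exp_sub (expect_exp_sum_deg_sub_meanDeg_le hn hθ₀ hθ 0) fun G hG => ?_
  have hG : x * √n ^ 3 < ∑ i, deg G i := hG
  simp only [meanDeg_zero, Pi.zero_apply, Finset.sum_const_zero, sub_zero]
  gcongr
  rw [le_div_iff₀ (by positivity)]
  exact hG.le

theorem prob_sum_deg_le_le (hn : 2 ≤ n) (hθ₀ : 0 ≤ θ) (hθ : θ ≤ 1 / 2) {x : ℝ}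
    (hx : 2 * x * √n ^ 3 ≤ ∑ i, meanDeg θ β i) :
    prob θ β {G | ∑ i, deg G i ≤ x * √n ^ 3} ≤ exp (1 - x / 2) := by
  refine prob_le_exp_sub (expect_exp_sum_meanDeg_sub_deg_le hn hθ₀ hθ β) fun G hG => ?_
  have hG : ∑ i, deg G i ≤ x * √n ^ 3 := hG
  gcongr
  rw [le_div_iff₀ (by positivity)]
  linarith

theorem totalDegreeTest_eq_one_iff {L : ℝ} {G : SimpleGraph (Fin n)} :
    totalDegreeTest L G = 1 ↔ L < ∑ i, deg G i := by
  simp only [totalDegreeTest]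
  split_ifs with h <;> simp [h]

theorem totalDegreeTest_eq_zero_iff {L : ℝ} {G : SimpleGraph (Fin n)} :
    totalDegreeTest L G = 0 ↔ ∑ i, deg G i ≤ L := by
  simp only [totalDegreeTest, ← not_lt]
  split_ifs with h <;> simp [h]

theorem risk_totalDegreeTest_le (hn : 2 ≤ n) (hθ₀ : 0 ≤ θ) (hθ : θ ≤ 1 / 2) {s A a x : ℝ}
    (ha : 0 ≤ a) (haA : a ≤ A)
    (hx : ∀ S : Finset (Fin n), S.card = ⌈s⌉₊ →
      2 * x * √n ^ 3 ≤ ∑ i, meanDeg θ ((S : Set (Fin n)).indicator fun _ => a) i) :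
    risk θ 0 s A (totalDegreeTest (n := n) (x * √n ^ 3)) ≤ 2 * exp (1 - x / 2) := by
  rw [two_mul, risk]
  simp only [totalDegreeTest_eq_one_iff, totalDegreeTest_eq_zero_iff]
  refine add_le_add (prob_lt_sum_deg_le hn hθ₀ hθ x)
    (Real.sSup_le (Set.forall_mem_image.2 fun β hβ => ?_) (exp_pos _).le)
  obtain ⟨S, hS, hle⟩ := exists_const_add_indicator_le ha haA hβ
  rw [show (fun _ => 0 : Fin n → ℝ) = 0 from rfl, zero_add] at hle
  refine (prob_anti_field hθ₀ hle fun G H hHG hG => ?_).trans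
    (prob_sum_deg_le_le hn hθ₀ hθ (hx S hS))
  exact (Finset.sum_le_sum fun i _ => deg_mono i hHG).trans hG

end TotalDegree

section Critical

theorem add_add_cube_le {a b c : ℝ} (ha : 0 ≤ a) (hb : 0 ≤ b) (hc : 0 ≤ c) :
    (a + b + c) ^ 3 ≤ 9 * (a ^ 3 + b ^ 3 + c ^ 3) := by
  have h := pow_sum_le_card_mul_sum_pow (s := Finset.univ) (f := ![a, b, c])
    (by simp [Fin.forall_fin_succ, ha, hb, hc]) 2
  norm_num [Fin.sum_univ_three] at h
  exact h

theorem posPart_cube_le_of_le_add_div_two {x a b : ℝ} (h : x ≤ (a + b) / 2) :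
    x⁺ ^ 3 ≤ (a⁺ ^ 3 + b⁺ ^ 3) / 2 := by
  have hx : x⁺ ≤ (a⁺ + b⁺) / 2 :=
    sup_le (by linarith [le_posPart a, le_posPart b])
      (by linarith [posPart_nonneg a, posPart_nonneg b])
  calc x⁺ ^ 3 ≤ ((a⁺ + b⁺) / 2) ^ 3 := by gcongr
    _ ≤ (a⁺ ^ 3 + b⁺ ^ 3) / 2 := by
      have := add_pow_le (posPart_nonneg a) (posPart_nonneg b) 3
      norm_num at this
      linarith

variable {n : ℕ} {θ : ℝ} {β : Fin n → ℝ}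

theorem expect_deg_sub_meanDeg_posPart_cube_le (hn : 2 ≤ n) (hθ₀ : 0 ≤ θ) (hθ : θ ≤ 1 / 2)
    (β : Fin n → ℝ) (i : Fin n) :
    expect θ β (fun G => (deg G i - meanDeg θ β i)⁺ ^ 3) ≤ 6 * exp 4 * √n ^ 3 := by
  have hsqrt : 0 < √(n : ℝ) := by positivity
  have hcube (G : SimpleGraph (Fin n)) : (deg G i - meanDeg θ β i)⁺ ^ 3 ≤
      6 * √n ^ 3 * exp (1 / 2 * (Pi.single i (2 / √n) : Fin n → ℝ) ⬝ᵥ (deg G - meanDeg θ β)) := by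
    convert posPart_cube_le_mul_exp_div hsqrt (deg G i - meanDeg θ β i) using 3
    rw [single_dotProduct, Pi.sub_apply]
    ring
  have htail := expect_exp_deg_sub_meanDeg_le (δ := Pi.single i (2 / √n)) hn hθ₀ hθ β
    (Pi.single_nonneg.2 (by positivity))
  calc expect θ β (fun G => (deg G i - meanDeg θ β i)⁺ ^ 3)
      ≤ 6 * √n ^ 3 * exp (n * (∑ j, (Pi.single i (2 / √n) : Fin n → ℝ) j) ^ 2) := by
        refine (expect_mono hcube).trans ?_
        rw [expect_const_mul]
        gcongr
    _ = 6 * exp 4 * √n ^ 3 := by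
        rw [Fintype.sum_pi_single', div_pow, sq_sqrt n.cast_nonneg]
        field_simp
        norm_num

/-- At `θ = 1 / 2` the linear terms of the mean-field equations cancel up to relative order `1 / n`,
which leaves the cubic term of `tanh` to balance the field. -/
theorem sub_one_mul_sum_field_le (hn : 2 ≤ n) (β : Fin n → ℝ) :
    ((n : ℝ) - 1) * ∑ i, β i ≤ (∑ i, meanDeg (1 / 2) β i) / (n - 1) +
      (∑ i, ∑ j ∈ Finset.univ.erase i,
        expect (1 / 2) β fun G => (localField (1 / 2) β i j G)⁺ ^ 3) / 3 := by
  have hN := one_le_natCast_sub_one hn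
  have htanh (i j : Fin n) : expect (1 / 2) β (localField (1 / 2) β i j) -
      1 / 3 * expect (1 / 2) β (fun G => (localField (1 / 2) β i j G)⁺ ^ 3) ≤
        expect (1 / 2) β fun G => tanh (localField (1 / 2) β i j G) := by
    rw [← expect_const_mul, ← expect_sub]
    exact expect_mono fun G => by linarith [sub_posPart_cube_le_tanh (localField (1 / 2) β i j G)]
  have hsum := Finset.sum_le_sum fun i (_ : i ∈ Finset.univ) =>
    Finset.sum_le_sum fun j (_ : j ∈ Finset.univ.erase i) => htanh i j
  simp only [Finset.sum_sub_distrib, ← Finset.mul_sum, sum_erase_expect_localField,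
    ← meanDeg_eq_sum_expect_tanh, Finset.sum_add_distrib, ← Finset.sum_div, Finset.sum_const,
    Finset.card_univ, Fintype.card_fin, nsmul_eq_mul] at hsum
  have hlinear : 1 / 2 / ((n : ℝ) - 1) * (((n : ℝ) - 4) * (∑ i, meanDeg (1 / 2) β i) +
      n * ∑ i, meanDeg (1 / 2) β i) =
        ∑ i, meanDeg (1 / 2) β i - (∑ i, meanDeg (1 / 2) β i) / (n - 1) := by
    field_simp
    ring
  linarith

/-- The contribution of the vertex `i` to the local fields of its pairs at the critical temperature
`θ = 1 / 2`; the summand `1` absorbs the entry `Y_ij` excluded from `localField`. -/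
noncomputable def siteField (β : Fin n → ℝ) (i : Fin n) (G : SimpleGraph (Fin n)) : ℝ :=
  (deg G i + 1) / (n - 1) + β i

theorem localField_le_siteField_add_siteField (hn : 2 ≤ n) (β : Fin n → ℝ) {i j : Fin n}
    (hij : i ≠ j) (G : SimpleGraph (Fin n)) :
    localField (1 / 2) β i j G ≤ (siteField β i G + siteField β j G) / 2 := by
  have hN : (0 : ℝ) < n - 1 := zero_lt_one.trans_le (one_le_natCast_sub_one hn)
  have hadj : -1 ≤ adj G i j := by
    rcases adj_eq_one_or G hij with h | h <;> norm_num [h]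
  calc localField (1 / 2) β i j G
      ≤ 1 / 2 / (n - 1) * (deg G i + deg G j + 2) + (β i + β j) / 2 := by
        unfold localField
        gcongr
        linarith
    _ = (siteField β i G + siteField β j G) / 2 := by
        unfold siteField
        ring

theorem sum_sum_expect_localField_posPart_cube_le (hn : 2 ≤ n) (β : Fin n → ℝ) :
    ∑ i, ∑ j ∈ Finset.univ.erase i, expect (1 / 2) β (fun G => (localField (1 / 2) β i j G)⁺ ^ 3) ≤
      (n - 1) * ∑ i, expect (1 / 2) β fun G => (siteField β i G)⁺ ^ 3 := by
  set M : Fin n → ℝ := fun i => expect (1 / 2) β fun G => (siteField β i G)⁺ ^ 3 with hM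
  have hpair (i j : Fin n) (hij : i ≠ j) :
      expect (1 / 2) β (fun G => (localField (1 / 2) β i j G)⁺ ^ 3) ≤ 1 / 2 * (M i + M j) := by
    rw [hM, ← expect_add, ← expect_const_mul]
    refine expect_mono fun G => ?_
    linarith [posPart_cube_le_of_le_add_div_two
      (localField_le_siteField_add_siteField hn β hij G)]
  calc _ ≤ ∑ i, ∑ j ∈ Finset.univ.erase i, 1 / 2 * (M i + M j) :=
        Finset.sum_le_sum fun i _ => Finset.sum_le_sum fun j hj =>
          hpair i j (Finset.ne_of_mem_erase hj).symm
    _ = (n - 1) * ∑ i, M i := by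
        simp only [Finset.sum_erase_eq_sub (Finset.mem_univ _), ← Finset.mul_sum,
          Finset.sum_add_distrib, Finset.sum_sub_distrib, Finset.sum_const, Finset.card_univ,
          Fintype.card_fin, nsmul_eq_mul]
        ring

theorem siteField_le (hn : 2 ≤ n) (hβ : 0 ≤ β) (i : Fin n) (G : SimpleGraph (Fin n)) :
    siteField β i G ≤ (deg G i - meanDeg (1 / 2) β i) / (n - 1) +
      ((∑ j, meanDeg (1 / 2) β j) / (n - 1) + 1) / (n - 1) + ((∑ j, β j) / (n - 1) + 2 * β i) := by
  have hN : (0 : ℝ) < n - 1 := zero_lt_one.trans_le (one_le_natCast_sub_one hn)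
  have hβi : 0 ≤ β i := hβ i
  have hmean := meanDeg_le hn (by norm_num) le_rfl hβ i
  have hmean' : meanDeg (1 / 2) β i / (n - 1) ≤
      ((∑ j, meanDeg (1 / 2) β j) / (n - 1) + (n - 1) * β i + ∑ j, β j) / (n - 1) := by
    gcongr
    linarith
  rw [add_div, add_div, mul_div_cancel_left₀ _ hN.ne'] at hmean'
  rw [siteField, add_div, sub_div, add_div _ 1]
  linarith

theorem expect_siteField_posPart_cube_le (hn : 2 ≤ n) (hβ : 0 ≤ β) (i : Fin n) :
    expect (1 / 2) β (fun G => (siteField β i G)⁺ ^ 3) ≤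
      9 * (6 * exp 4 * (√n / (n - 1)) ^ 3 +
        (((∑ j, meanDeg (1 / 2) β j) / (n - 1) + 1) / (n - 1)) ^ 3 +
          ((∑ j, β j) / (n - 1) + 2 * β i) ^ 3) := by
  have hN : (0 : ℝ) < n - 1 := zero_lt_one.trans_le (one_le_natCast_sub_one hn)
  have hK : 0 ≤ ∑ j, meanDeg (1 / 2) β j :=
    Finset.sum_nonneg fun j _ => meanDeg_nonneg (by norm_num) hβ j
  have hσ : 0 ≤ ∑ j, β j := Finset.sum_nonneg fun j _ => hβ j
  have hβi : 0 ≤ β i := hβ i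
  set v := ((∑ j, meanDeg (1 / 2) β j) / (n - 1) + 1) / ((n : ℝ) - 1)
  set w := (∑ j, β j) / ((n : ℝ) - 1) + 2 * β i
  have hv₀ : 0 ≤ v := by positivity
  have hw₀ : 0 ≤ w := by positivity
  have hcube (G : SimpleGraph (Fin n)) : (siteField β i G)⁺ ^ 3 ≤
      9 * (((n : ℝ) - 1)⁻¹ ^ 3 * (deg G i - meanDeg (1 / 2) β i)⁺ ^ 3 + (v ^ 3 + w ^ 3)) := by
    have hle : (siteField β i G)⁺ ≤ (deg G i - meanDeg (1 / 2) β i)⁺ / (n - 1) + v + w := by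
      refine sup_le ((siteField_le hn hβ i G).trans ?_) (by positivity)
      gcongr
      exact le_posPart _
    calc _ ≤ ((deg G i - meanDeg (1 / 2) β i)⁺ / (n - 1) + v + w) ^ 3 := by gcongr
      _ ≤ _ := add_add_cube_le (by positivity) hv₀ hw₀
      _ = _ := by ring
  have htail := expect_deg_sub_meanDeg_posPart_cube_le hn (by norm_num) le_rfl β i
  refine (expect_mono hcube).trans ?_
  rw [expect_const_mul, expect_add, expect_const, expect_const_mul]
  calc _ ≤ 9 * (((n : ℝ) - 1)⁻¹ ^ 3 * (6 * exp 4 * √n ^ 3) + (v ^ 3 + w ^ 3)) := by gcongr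
    _ = _ := by ring

end Critical

section CubeLaw

variable {n : ℕ} {β : Fin n → ℝ}

theorem natCast_div_sub_one_le_two (hn : 2 ≤ n) : (n : ℝ) / (n - 1) ≤ 2 := by
  have hN := one_le_natCast_sub_one hn
  rw [div_le_iff₀ (by linarith)]
  linarith

theorem sqrt_natCast_div_sub_one_le (hn : 2 ≤ n) : √(n : ℝ) / (n - 1) ≤ 2 / √n := by
  rw [le_div_iff₀ (by positivity), div_mul_eq_mul_div, mul_self_sqrt n.cast_nonneg]
  exact natCast_div_sub_one_le_two hn

theorem mul_sqrt_natCast_cube_div_sub_one_le (hn : 2 ≤ n) {x : ℝ} (hx : 0 ≤ x) :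
    x * √n ^ 3 / ((n : ℝ) - 1) ≤ 2 * x * √n := by
  calc x * √n ^ 3 / ((n : ℝ) - 1) = x * √n ^ 2 * (√n / (n - 1)) := by ring
    _ ≤ x * √n ^ 2 * (2 / √n) :=
      mul_le_mul_of_nonneg_left (sqrt_natCast_div_sub_one_le hn) (by positivity)
    _ = 2 * x * √n := by field_simp

theorem natCast_mul_sqrt_natCast_cube_div_sq_le (hn : 2 ≤ n) :
    n * (√n ^ 3 / ((n : ℝ) - 1) ^ 2) ≤ 4 * √n := by
  have hN : (0 : ℝ) < n - 1 := zero_lt_one.trans_le (one_le_natCast_sub_one hn)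
  have hratio := natCast_div_sub_one_le_two hn
  calc n * (√n ^ 3 / ((n : ℝ) - 1) ^ 2) = √n * (n * √n ^ 2 / (n - 1) ^ 2) := by ring
    _ = √n * (n / (n - 1)) ^ 2 := by
      rw [sq_sqrt n.cast_nonneg, ← sq, div_pow]
    _ ≤ √n * 2 ^ 2 := by gcongr
    _ = 4 * √n := by ring

theorem natCast_mul_sub_one_mul_cube_le (hn : 2 ≤ n) {x : ℝ} (hx : 0 ≤ x) :
    n * ((n : ℝ) - 1) * ((x * √n ^ 3 / (n - 1) + 1) / (n - 1)) ^ 3 ≤ 64 * (1 + x) ^ 3 * √n := by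
  have hN := one_le_natCast_sub_one hn
  have hsqrt : 1 ≤ √(n : ℝ) := one_le_sqrt.2 (by linarith)
  have hsite : (x * √n ^ 3 / ((n : ℝ) - 1) + 1) / (n - 1) ≤ 4 * (1 + x) / √n := by
    calc (x * √n ^ 3 / ((n : ℝ) - 1) + 1) / (n - 1) ≤ 2 * (1 + x) * √n / (n - 1) := by
          gcongr
          linarith [mul_sqrt_natCast_cube_div_sub_one_le hn hx]
      _ = 2 * (1 + x) * (√n / (n - 1)) := by ring
      _ ≤ 2 * (1 + x) * (2 / √n) :=
          mul_le_mul_of_nonneg_left (sqrt_natCast_div_sub_one_le hn) (by positivity)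
      _ = 4 * (1 + x) / √n := by ring
  calc _ ≤ √n ^ 2 * √n ^ 2 * (4 * (1 + x) / √n) ^ 3 := by
        rw [sq_sqrt n.cast_nonneg]
        gcongr
        linarith
    _ = 64 * (1 + x) ^ 3 * √n := by
        field_simp
        norm_num

theorem sum_field_cube_le (hn : 2 ≤ n) (hβ : 0 ≤ β) {c : ℝ} (hβc : ∀ i, β i ≤ c) :
    ∑ i, ((∑ j, β j) / ((n : ℝ) - 1) + 2 * β i) ^ 3 ≤ 64 * c ^ 2 * ∑ i, β i := by
  have hN : (0 : ℝ) < n - 1 := zero_lt_one.trans_le (one_le_natCast_sub_one hn)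
  have hratio := natCast_div_sub_one_le_two hn
  set σ := ∑ j, β j
  have hσ : 0 ≤ σ := Finset.sum_nonneg fun j _ => hβ j
  have hmean : σ / (n - 1) ≤ 2 * c := by
    have hle : σ ≤ n * c := by
      simpa using Finset.sum_le_card_nsmul Finset.univ β c fun i _ => hβc i
    have hc : 0 ≤ c := (hβ ⟨0, by omega⟩).trans (hβc _)
    calc σ / (n - 1) ≤ n * c / (n - 1) := by gcongr
      _ = n / (n - 1) * c := by ring
      _ ≤ 2 * c := by gcongr
  have hterm (i : Fin n) :
      (σ / ((n : ℝ) - 1) + 2 * β i) ^ 3 ≤ (4 * c) ^ 2 * (σ / (n - 1) + 2 * β i) := by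
    have hβi : 0 ≤ β i := hβ i
    rw [pow_succ]
    gcongr
    linarith [hβc i]
  calc _ ≤ ∑ i, (4 * c) ^ 2 * (σ / ((n : ℝ) - 1) + 2 * β i) := Finset.sum_le_sum fun i _ => hterm i
    _ = 16 * c ^ 2 * ((n / (n - 1) + 2) * σ) := by
      simp only [← Finset.mul_sum, Finset.sum_add_distrib, Finset.sum_const, Finset.card_univ,
        Fintype.card_fin, nsmul_eq_mul]
      ring
    _ ≤ 16 * c ^ 2 * ((2 + 2) * σ) := by gcongr
    _ = _ := by ring

theorem sub_one_mul_sum_field_le_of_le (hn : 2 ≤ n) (hβ : 0 ≤ β) (hβ' : ∀ i, β i ≤ 1 / 20) :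
    ((n : ℝ) - 1) * ∑ i, β i ≤ 2 * ((∑ i, meanDeg (1 / 2) β i) / (n - 1) +
      18 * exp 4 * (n * (√n ^ 3 / (n - 1) ^ 2)) +
        3 * (n * (n - 1)) * (((∑ i, meanDeg (1 / 2) β i) / (n - 1) + 1) / (n - 1)) ^ 3) := by
  have hN : (0 : ℝ) < n - 1 := zero_lt_one.trans_le (one_le_natCast_sub_one hn)
  have hσ : 0 ≤ ∑ j, β j := Finset.sum_nonneg fun j _ => hβ j
  have hlinear := sub_one_mul_sum_field_le hn β
  have hpairs := sum_sum_expect_localField_posPart_cube_le hn β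
  have hsites := Finset.sum_le_sum fun i (_ : i ∈ Finset.univ) =>
    expect_siteField_posPart_cube_le hn hβ i
  have hfield := sum_field_cube_le hn hβ hβ'
  set b := ((∑ i, meanDeg (1 / 2) β i) / (n - 1) + 1) / ((n : ℝ) - 1)
  simp only [← Finset.mul_sum, Finset.sum_add_distrib, Finset.sum_const, Finset.card_univ,
    Fintype.card_fin, nsmul_eq_mul] at hsites
  have hcubes : ((n : ℝ) - 1) * ∑ i, expect (1 / 2) β (fun G => (siteField β i G)⁺ ^ 3) ≤
      (n - 1) * (9 * (n * (6 * exp 4 * (√n / (n - 1)) ^ 3) + n * b ^ 3 +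
        64 * (1 / 20) ^ 2 * ∑ i, β i)) := by
    gcongr
    linarith
  -- With `β ≤ 1 / 20` the cubes of the fields cost at most half of the left-hand side.
  have hcancel : ((n : ℝ) - 1) * (√n / (n - 1)) ^ 3 = √n ^ 3 / (n - 1) ^ 2 := by field_simp
  rw [← hcancel]
  linarith [mul_nonneg hN.le hσ]

theorem sqrt_mul_sum_field_le (hn : 2 ≤ n) (hβ : 0 ≤ β) (hβ' : ∀ i, β i ≤ 1 / 20) :
    √n * ∑ i, β i ≤
      (776 + 288 * exp 4) * (1 + (∑ i, meanDeg (1 / 2) β i) / √n ^ 3) ^ 3 := by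
  have hbound := sub_one_mul_sum_field_le_of_le hn hβ hβ'
  have hN := one_le_natCast_sub_one hn
  have hσ : 0 ≤ ∑ j, β j := Finset.sum_nonneg fun j _ => hβ j
  obtain ⟨x, hx⟩ : ∃ x, (∑ i, meanDeg (1 / 2) β i) / √n ^ 3 = x := ⟨_, rfl⟩
  have hx₀ : 0 ≤ x := hx ▸ div_nonneg
    (Finset.sum_nonneg fun j _ => meanDeg_nonneg (by norm_num) hβ j) (by positivity)
  rw [hx]
  rw [div_eq_iff (by positivity)] at hx
  rw [hx] at hbound
  have hmean := mul_sqrt_natCast_cube_div_sub_one_le hn hx₀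
  have hfluct := mul_le_mul_of_nonneg_left (natCast_mul_sqrt_natCast_cube_div_sq_le hn)
    (exp_pos 4).le
  have hsite := natCast_mul_sub_one_mul_cube_le hn hx₀
  have hsum : √n * (√n * ∑ i, β i) ≤
      √n * (8 * x + 288 * exp 4 + 768 * (1 + x) ^ 3) := by
    have hhalf : n / 2 * ∑ i, β i ≤ (n - 1) * ∑ i, β i := by
      gcongr
      linarith
    rw [← mul_assoc, mul_self_sqrt n.cast_nonneg]
    linarith
  have hone : 1 ≤ (1 + x) ^ 3 := one_le_pow₀ (by linarith)
  have hself : 1 + x ≤ (1 + x) ^ 3 := le_self_pow₀ (by linarith) three_ne_zero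
  calc √n * ∑ i, β i ≤ 8 * x + 288 * exp 4 + 768 * (1 + x) ^ 3 :=
        le_of_mul_le_mul_left hsum (by positivity)
    _ ≤ 8 * (1 + x) ^ 3 + 288 * exp 4 * (1 + x) ^ 3 + 768 * (1 + x) ^ 3 := by
        linarith [mul_le_mul_of_nonneg_left hone (exp_pos 4).le]
    _ = _ := by ring

end CubeLaw

section Detection

theorem rpow_sub_one_mul_le_sum_meanDeg {n : ℕ} (hn : 2 ≤ n) {s a : ℝ} (hs : 0 ≤ s) (ha : 0 ≤ a)
    (ha' : a ≤ 1 / 20) {S : Finset (Fin n)} (hS : S.card = ⌈s⌉₊) :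
    ((s * a * √n / (776 + 288 * exp 4)) ^ (3⁻¹ : ℝ) - 1) * √n ^ 3 ≤
      ∑ i, meanDeg (1 / 2) ((S : Set (Fin n)).indicator fun _ => a) i := by
  have hindicator : (0 : Fin n → ℝ) ≤ (S : Set (Fin n)).indicator fun _ => a :=
    Set.indicator_nonneg fun _ _ => ha
  have hresponse := sqrt_mul_sum_field_le hn hindicator
    (Set.indicator_le_self' (fun _ _ => ha) |>.trans fun _ => ha')
  have hx : 0 ≤ (∑ i, meanDeg (1 / 2) ((S : Set (Fin n)).indicator fun _ => a) i) / √n ^ 3 :=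
    div_nonneg (Finset.sum_nonneg fun i _ => meanDeg_nonneg (by norm_num) hindicator i)
      (by positivity)
  have hroot : s * a * √n / (776 + 288 * exp 4) ≤
      (1 + (∑ i, meanDeg (1 / 2) ((S : Set (Fin n)).indicator fun _ => a) i) / √n ^ 3) ^ 3 := by
    rw [div_le_iff₀' (by positivity)]
    refine le_trans ?_ hresponse
    rw [sum_indicator_const, hS, mul_comm]
    gcongr
    exact Nat.le_ceil s
  rw [← le_div_iff₀ (by positivity), sub_le_iff_le_add']
  calc _ ≤ _ := rpow_le_rpow (by positivity) hroot (by norm_num)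
    _ = _ := by exact_mod_cast pow_rpow_inv_natCast (by positivity) three_ne_zero

theorem tendsto_mul_min_mul_sqrt_atTop {s A : ℕ → ℝ} {c : ℝ} (hc : 0 < c)
    (hs : ∀ᶠ n in atTop, 1 ≤ s n)
    (hsignal : Tendsto (fun n : ℕ => s n * A n * √n) atTop atTop) :
    Tendsto (fun n : ℕ => s n * min (A n) c * √n) atTop atTop := by
  have hsqrt : Tendsto (fun n : ℕ => c * √n) atTop atTop :=
    (tendsto_sqrt_atTop.comp tendsto_natCast_atTop_atTop).const_mul_atTop hc
  refine tendsto_atTop.2 fun K => ?_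
  filter_upwards [hs, hsignal.eventually_ge_atTop K, hsqrt.eventually_ge_atTop K]
    with n hsn hKA hKc
  rcases min_cases (A n) c with ⟨h, -⟩ | ⟨h, -⟩ <;> rw [h]
  · exact hKA
  · rw [mul_assoc]
    exact hKc.trans (le_mul_of_one_le_left (by positivity) hsn)

theorem exists_asympPowerful_totalDegreeTest {s A : ℕ → ℝ} (hs : ∀ᶠ n in atTop, 1 ≤ s n)
    (hsignal : Tendsto (fun n : ℕ => s n * A n * √n) atTop atTop) :
    ∃ L : ℕ → ℝ, Tendsto (fun n : ℕ => L n / (n : ℝ) ^ (3 / 2 : ℝ)) atTop atTop ∧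
      AsympPowerful (1 / 2) 0 s A fun n => totalDegreeTest (L n) := by
  -- Half of the lower bound for the mean total degree, in units of `n ^ (3 / 2)`.
  set x : ℕ → ℝ := fun n =>
    ((s n * min (A n) (1 / 20) * √n / (776 + 288 * exp 4)) ^ (3⁻¹ : ℝ) - 1) / 2 with hx
  have hx_lim : Tendsto x atTop atTop := by
    refine (tendsto_atTop_add_const_right _ (-1) <| (tendsto_rpow_atTop (by norm_num)).comp <|
      Tendsto.atTop_div_const (by positivity) ?_).atTop_div_const two_pos
    exact tendsto_mul_min_mul_sqrt_atTop (by norm_num) hs hsignal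
  have hrisk : ∀ᶠ n : ℕ in atTop, risk (1 / 2) 0 (s n) (A n)
      (totalDegreeTest (n := n) (x n * √n ^ 3)) ≤ 2 * exp (1 - x n / 2) := by
    filter_upwards [hs, hsignal.eventually_gt_atTop 0, eventually_ge_atTop 2] with n hsn hpos hn
    have hs₀ : 0 ≤ s n := zero_le_one.trans hsn
    have hA : 0 < A n := by
      rw [mul_right_comm] at hpos
      exact pos_of_mul_pos_right hpos (by positivity)
    have ha : 0 ≤ min (A n) (1 / 20) := le_min hA.le (by norm_num)
    refine risk_totalDegreeTest_le hn (by norm_num) le_rfl ha (min_le_left _ _) fun S hS => ?_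
    rw [hx, mul_div_cancel₀ _ two_ne_zero]
    exact rpow_sub_one_mul_le_sum_meanDeg hn hs₀ ha (min_le_right _ _) hS
  refine ⟨fun n => x n * √n ^ 3, hx_lim.congr' ?_, ?_⟩
  · filter_upwards [eventually_ne_atTop 0] with n hn
    have hpow : (n : ℝ) ^ (3 / 2 : ℝ) = √n ^ 3 := by
      rw [rpow_div_two_eq_sqrt _ n.cast_nonneg]
      norm_cast
    rw [hpow, mul_div_cancel_right₀ _ (by positivity)]
  · refine squeeze_zero' (.of_forall fun n => risk_nonneg _ _ _ _ _) hrisk ?_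
    have hexponent : Tendsto (fun n => 1 - x n / 2) atTop atBot :=
      tendsto_atBot_add_const_left _ 1 <|
        tendsto_neg_atTop_atBot.comp (hx_lim.atTop_div_const two_pos)
    simpa using (tendsto_exp_atBot.comp hexponent).const_mul 2

end Detection

section Polynomial

theorem eventually_natCast_rpow_mem_Icc {b : ℝ} (hb₀ : 0 ≤ b) (hb₁ : b ≤ 1) :
    ∀ᶠ n : ℕ in atTop, (n : ℝ) ^ b ∈ Set.Icc 1 (n : ℝ) := by
  filter_upwards [eventually_ge_atTop 1] with n hn
  have hn' : (1 : ℝ) ≤ n := Nat.one_le_cast.2 hn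
  exact ⟨one_le_rpow hn' hb₀, (rpow_le_rpow_of_exponent_le hn' hb₁).trans_eq (rpow_one _)⟩

theorem eventually_natCast_rpow_pos (t : ℝ) : ∀ᶠ n : ℕ in atTop, 0 < (n : ℝ) ^ t := by
  filter_upwards [eventually_ne_atTop 0] with n hn
  positivity

theorem natCast_rpow_add_half_eventuallyEq (b t : ℝ) :
    (fun n : ℕ => (n : ℝ) ^ (b + t + 1 / 2)) =ᶠ[atTop] fun n => (n : ℝ) ^ b * n ^ t * √n := by
  filter_upwards [eventually_ne_atTop 0] with n hn
  rw [sqrt_eq_rpow, rpow_add (by positivity), rpow_add (by positivity)]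

theorem isBoundedUnder_rpow_mul_rpow_mul_sqrt {b t : ℝ} (h : b + t + 1 / 2 ≤ 0) :
    IsBoundedUnder (· ≤ ·) atTop fun n : ℕ => (n : ℝ) ^ b * n ^ t * √n := by
  refine ⟨1, eventually_map.2 ?_⟩
  filter_upwards [natCast_rpow_add_half_eventuallyEq b t, eventually_ge_atTop 1] with n hsignal hn
  rw [← hsignal]
  exact rpow_le_one_of_one_le_of_nonpos (Nat.one_le_cast.2 hn) h

theorem tendsto_rpow_mul_rpow_mul_sqrt_atTop {b t : ℝ} (h : 0 < b + t + 1 / 2) :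
    Tendsto (fun n : ℕ => (n : ℝ) ^ b * n ^ t * √n) atTop atTop :=
  ((tendsto_rpow_atTop h).comp tendsto_natCast_atTop_atTop).congr'
    (natCast_rpow_add_half_eventuallyEq b t)

end Polynomial

end TwoStar

theorem theorem5_general (s A : ℕ → ℝ) (hs : ∀ᶠ n : ℕ in atTop, s n ∈ Set.Icc 1 (n : ℝ)) :
    ((∀ᶠ n in atTop, 0 < A n) → IsBoundedUnder (· ≤ ·) atTop (fun n : ℕ => s n * A n * √n) →
      ∀ θ : ℝ, 0 ≤ θ → θ ≤ 1 / 2 → ∀ (β₀ : ℝ) (T : ∀ n, SimpleGraph (Fin n) → Fin 2),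
        TwoStar.AsympNotPowerful θ β₀ s A T) ∧
    (Tendsto (fun n : ℕ => s n * A n * √n) atTop atTop →
      ∃ L : ℕ → ℝ,
        Tendsto (fun n : ℕ => L n / (n : ℝ) ^ (3 / 2 : ℝ)) atTop atTop ∧
        TwoStar.AsympPowerful (1 / 2) 0 s A (fun n => TwoStar.totalDegreeTest (L n))) :=
  ⟨fun hA hbdd _ hθ₀ hθ β₀ T =>
      TwoStar.asympNotPowerful_of_isBoundedUnder hθ₀ hθ β₀ hs hA hbdd T,
    TwoStar.exists_asympPowerful_totalDegreeTest (hs.mono fun _ h => h.1)⟩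

theorem theorem5 (b t : ℝ) (hb₀ : 0 < b) (hb₁ : b < 1) (ht : t < 0) :
    (b + t + 1 / 2 < 0 →
      ∀ T : ∀ n, SimpleGraph (Fin n) → Fin 2,
        TwoStar.AsympNotPowerful (1 / 2) 0 (fun n => (n : ℝ) ^ b) (fun n => (n : ℝ) ^ t) T) ∧
    (0 < b + t + 1 / 2 →
      ∃ L : ℕ → ℝ,
        Tendsto (fun n : ℕ => L n / (n : ℝ) ^ (3 / 2 : ℝ)) atTop atTop ∧
        TwoStar.AsympPowerful (1 / 2) 0 (fun n => (n : ℝ) ^ b) (fun n => (n : ℝ) ^ t)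
          (fun n => TwoStar.totalDegreeTest (L n))) :=
  (theorem5_general _ _ (TwoStar.eventually_natCast_rpow_mem_Icc hb₀.le hb₁.le)).imp
    (fun hlower h => hlower (TwoStar.eventually_natCast_rpow_pos t)
      (TwoStar.isBoundedUnder_rpow_mul_rpow_mul_sqrt h.le) _ (by norm_num) le_rfl _)
    fun hupper h => hupper (TwoStar.tendsto_rpow_mul_rpow_mul_sqrt_atTop h)
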